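/- For an algebraic number $\alpha\in\mathbb C$ of degree $d$ over $\mathbb Q$ with minimal polynomial $a\prod_{i=1}^{d}(X-\alpha^{(i)})$ over $\mathbb Z$ (the primitive integer polynomial vanishing at $\alpha$, with complex roots $\alpha^{(i)}$), let $$h(\alpha)=\frac1d\Big(\log|a|+\sum_{i=1}^{d}\log\max(1,|\alpha^{(i)}|)\Big)$$ be its absolute logarithmic Weil height. For integers $m,n\ge 0$ put $$D_{m,n}=\frac{m!}{\prod_{q\le n,\ q\text{ prime}}q^{v_q(m!)}},$$ where $v_q$ is the $q$-adic valuation, and let $d_n$ be the least common multiple of $1,\dots,n$, with $d_0=1$. **Theorem.** Let $\alpha,\beta\in\mathbb C$ be algebraic numbers with $\beta\neq 0$, and put $D=[\mathbb Q(\alpha,\beta):\mathbb Q]/[\mathbb R(\alpha,\beta):\mathbb R]$. Let $\mathcal A\ge 1$ and $\mathcal B\ge 1$ be real numbers such that $$D\,h(\alpha)-\log\max(1,|\alpha|)\le\log\mathcal A,\qquad D\,h(\beta)-\log\max(1,|\beta|)\le\log\mathcal B.$$ Let $K\ge 1$ and $L\ge 2$ be integers and let $E>1$ be a real number such that $$\begin{aligned}KL\log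 E\ \ge\ & DKL\log 2+D(K-1)\log\big(e\sqrt{3L}\,d_{L-1}\big)+D\log\big(D_{K-1,L-1}\big)\\&+D\log\Big((4e)^{L-1}\min\big(d_{L-2}^{\,K-1},(L-2)!\big)\Big)+\log\big((K-1)!\big)\\&+(K-1)\log(\mathcal B/2)+(L-1)\log(\mathcal A/2)+LE|\beta|+L\log E.\end{aligned}$$ Then $$\big|e^{\beta}-\alpha\big|\ \ge\ E^{-KL}.$$ -/

import Mathlib

open Polynomial IntermediateField

noncomputable section

/-- The minimal polynomial over `ℤ` of an algebraic number `α` (determined up to sign): the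
primitive polynomial with integer coefficients proportional to the monic minimal polynomial
of `α` over `ℚ`. -/
def intMinpoly (α : ℂ) : ℤ[X] :=
  (IsLocalization.integerNormalization (nonZeroDivisors ℤ) (minpoly ℚ α)).primPart

/-- The absolute logarithmic Weil height of an algebraic number `α`. -/
def weilHeight (α : ℂ) : ℝ :=
  (1 / ((intMinpoly α).natDegree : ℝ)) *
    (Real.log |((intMinpoly α).leadingCoeff : ℝ)| +
      (((intMinpoly α).aroots ℂ).map fun z => Real.log (max 1 ‖z‖)).sum)

/-- `[ℚ(α, β) : ℚ] / [ℝ(α, β) : ℝ]`, a real number (possibly a half-integer). -/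
def degreeRatio (α β : ℂ) : ℝ :=
  (Module.finrank ℚ ℚ⟮α, β⟯ : ℝ) / (Module.finrank ℝ ℝ⟮α, β⟯ : ℝ)

/-- `m!` divided by the product of `q ^ v_q(m!)` over the primes `q ≤ n`. -/
def factorialPart (m n : ℕ) : ℝ :=
  (m.factorial : ℝ) /
    ∏ q ∈ (Finset.Icc 1 n).filter Nat.Prime, (q : ℝ) ^ padicValNat q m.factorial

/-- The least common multiple of `1, …, n`, equal to `1` for `n = 0`. -/
def lcmUpTo (n : ℕ) : ℕ := (Finset.Icc 1 n).lcm id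

end

/-! Suppose `|e^β - α| < E^(-KL)` and put `M = K - 1`. Following Hermite, for each `j < L` consider
the sum of the residues at `ζ = 0, …, L - 1` of `e^(zζ) / ∏ (ζ - m)^(n m)`, where `n m = M` except
`n j = M + 1`. This is a form `∑ P_{j,l}(z) e^(lz)` with `deg P_{j,l} ≤ M`. Its `i`-th Taylor
coefficient is `1/i!` times the sum of the residues of `ζ^i / ∏ (ζ - m)^(n m)`, which is `0` for `i
< ML` because that function is `O(ζ⁻²)` (`residueSum_eq_zero`). The matrix `(P_{j,l})` has
determinant `c z^(ML)` with `c ≠ 0` (`det_padeMatrix`), so some form does not vanish when `z` is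
replaced by `β` and `e^z` by `α`. Residues are treated algebraically, as coefficients of power
series over `ℚ`.

Clearing denominators gives integers `p s l` of controlled total size `H` (`exists_int_pade_form`)
and a number `Λ = ∑ p s l β^s α^l ≠ 0`. High order of vanishing and the closeness of `α` to `e^β`
make `|Λ|` at most about `E^(-ML) H` (`norm_sum_le_of_vanishing_of_norm_exp_sub_le`). Liouville's
inequality bounds `|Λ|` below in terms of `H` and the heights (`liouville_inequality_degreeRatio`);
it rests on the integrality of a norm multiplied by powers of leading coefficients, tested on
valuation rings. Under the hypothesis on `E` the two bounds are incompatible, in the end because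
`log 2 < 1`. -/

/-! ### Valuation rings, Gauss's lemma and integrality -/

/-- The Gauss lemma inequality for a product of linear factors over a valuation ring. -/
lemma ValuationSubring.valuation_mul_prod_max_le_one {k : Type*} [Field k] (V : ValuationSubring k)
    (s : Multiset k) (a : k) (h : ∀ n, (C a * (s.map fun z => X - C z).prod).coeff n ∈ V) :
    V.valuation a * (s.map fun z => max 1 (V.valuation z)).prod ≤ 1 := by
  induction s using Multiset.induction_on generalizing a with
  | empty => simpa [V.valuation_le_one_iff] using h 0
  | cons z s ih =>
    simp only [Multiset.map_cons, Multiset.prod_cons] at h ⊢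
    set g := (s.map fun z => X - C z).prod with hg
    have hstep : ∀ n, (C a * ((X - C z) * g)).coeff (n + 1) =
        (C a * g).coeff n - z * (C a * g).coeff (n + 1) := by
      intro n
      have : C a * ((X - C z) * g) = X * (C a * g) - C z * (C a * g) := by ring
      rw [this, coeff_sub, coeff_X_mul, coeff_C_mul (p := C a * g)]
    have hzero : (C a * ((X - C z) * g)).coeff 0 = - (z * (C a * g).coeff 0) := by
      have : C a * ((X - C z) * g) = X * (C a * g) - C z * (C a * g) := by ring
      rw [this, coeff_sub, coeff_C_mul]
      simp
    by_cases hz : z ∈ V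
    · rw [max_eq_left ((V.valuation_le_one_iff z).2 hz), one_mul]
      apply ih
      -- For `z ∈ V`, division by `X - z` is run from the top: each coefficient of the quotient is
      -- an integral combination of the next one and a given coefficient.
      have hdesc : ∀ m n, (C a * g).natDegree < n + m → (C a * g).coeff n ∈ V := by
        intro m
        induction m with
        | zero =>
          intro n hn
          rw [coeff_eq_zero_of_natDegree_lt (by simpa using hn)]
          exact V.zero_mem
        | succ m ihm =>
          intro n hn
          have h1 := hstep n
          rw [eq_sub_iff_add_eq] at h1
          rw [← h1]
          exact V.add_mem _ _ (h _) (V.mul_mem _ _ hz (ihm (n + 1) (by omega)))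
      exact fun n => hdesc ((C a * g).natDegree + 1) n (by omega)
    · have hz1 : 1 < V.valuation z := by
        rw [← not_le, V.valuation_le_one_iff]; exact hz
      have hz0 : z ≠ 0 := by rintro rfl; exact hz V.zero_mem
      have hzi : z⁻¹ ∈ V := (V.mem_or_inv_mem z).resolve_left hz
      rw [max_eq_right hz1.le, ← mul_assoc, ← map_mul]
      apply ih
      intro n
      -- For `z ∉ V`, the factor `z` is moved into the leading constant and the recursion is run
      -- upwards, with the integral multiplier `z⁻¹`.
      have hC : ∀ n, (C (a * z) * g).coeff n = z * (C a * g).coeff n := by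
        intro n
        rw [coeff_C_mul, coeff_C_mul]; ring
      induction n with
      | zero =>
        rw [hC, ← neg_neg (z * _), ← hzero]
        exact V.neg_mem _ (h 0)
      | succ n ihn =>
        have h1 : (C (a * z) * g).coeff (n + 1) =
            z⁻¹ * (C (a * z) * g).coeff n - (C a * ((X - C z) * g)).coeff (n + 1) := by
          rw [hstep, hC, hC]; field_simp; ring
        rw [h1]
        exact sub_mem (V.mul_mem _ _ hzi ihn) (h _)

/-- Membership in the integral closure of `ℤ` may be tested on valuation rings. -/
lemma isIntegral_int_of_forall_valuationSubring {k : Type*} [Field k] {x : k}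
    (h : ∀ V : ValuationSubring k, x ∈ V) : IsIntegral ℤ x := by
  by_contra hx
  obtain ⟨V, -, hV⟩ := Subring.exists_le_valuationSubring_of_isIntegrallyClosedIn
    (R := (integralClosure ℤ k).toSubring) (x := x) hx
  exact hV (h V)

/-! ### The minimal polynomial over `ℤ` and conjugates -/

lemma exists_map_intMinpoly_eq {α : ℂ} (hα : IsAlgebraic ℚ α) :
    ∃ c : ℚ, c ≠ 0 ∧ (intMinpoly α).map (algebraMap ℤ ℚ) = C c * minpoly ℚ α := by
  set f := IsLocalization.integerNormalization (nonZeroDivisors ℤ) (minpoly ℚ α) with hf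
  obtain ⟨b, hb, hmap⟩ :=
    IsLocalization.integerNormalization_spec (nonZeroDivisors ℤ) (minpoly ℚ α)
  have hb0 : b ≠ 0 := nonZeroDivisors.ne_zero hb
  have hmp : minpoly ℚ α ≠ 0 := minpoly.ne_zero hα.isIntegral
  have hf0 : f ≠ 0 := by
    rw [hf, Ne, IsFractionRing.integerNormalization_eq_zero_iff]; exact hmp
  have hc0 : (f.content : ℚ) ≠ 0 := by
    exact_mod_cast content_eq_zero_iff.not.2 hf0
  refine ⟨(f.content : ℚ)⁻¹ * b, by simp [hc0, hb0], ?_⟩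
  have h1 : f.map (algebraMap ℤ ℚ) = C (f.content : ℚ) * (intMinpoly α).map (algebraMap ℤ ℚ) := by
    conv_lhs => rw [f.eq_C_content_mul_primPart]
    rw [Polynomial.map_mul, map_C]
    rfl
  have h2 : f.map (algebraMap ℤ ℚ) = C (b : ℚ) * minpoly ℚ α := by
    rw [hf, hmap]
    ext n
    simp
  rw [C_mul, mul_assoc, ← h2, h1, ← mul_assoc, ← C_mul, inv_mul_cancel₀ hc0]
  simp

lemma natDegree_intMinpoly {α : ℂ} (hα : IsAlgebraic ℚ α) :
    (intMinpoly α).natDegree = (minpoly ℚ α).natDegree := by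
  obtain ⟨c, hc, h⟩ := exists_map_intMinpoly_eq hα
  rw [← natDegree_map_eq_of_injective (algebraMap ℤ ℚ).injective_int, h, natDegree_C_mul hc]

lemma aroots_intMinpoly {α : ℂ} (hα : IsAlgebraic ℚ α) :
    (intMinpoly α).aroots ℂ = (minpoly ℚ α).aroots ℂ := by
  obtain ⟨c, hc, h⟩ := exists_map_intMinpoly_eq hα
  rw [← aroots_map ℂ ℚ, h, aroots_C_mul _ hc]

lemma intMinpoly_ne_zero {α : ℂ} (hα : IsAlgebraic ℚ α) : intMinpoly α ≠ 0 := by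
  obtain ⟨c, hc, h⟩ := exists_map_intMinpoly_eq hα
  intro h0
  rw [h0, Polynomial.map_zero, eq_comm, mul_eq_zero, C_eq_zero] at h
  exact h.elim hc (minpoly.ne_zero hα.isIntegral)

/-- Gauss's lemma for the factorization over `ℂ`: the coefficients are integers, so they lie in
every valuation ring. -/
lemma valuation_leadingCoeff_mul_prod_le_one {α : ℂ} (hα : IsAlgebraic ℚ α)
    (V : ValuationSubring ℂ) :
    V.valuation ((intMinpoly α).leadingCoeff : ℂ) *
      (((minpoly ℚ α).aroots ℂ).map fun z => max 1 (V.valuation z)).prod ≤ 1 := by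
  rw [← aroots_intMinpoly hα]
  apply V.valuation_mul_prod_max_le_one
  intro n
  have h := (IsAlgClosed.splits ((intMinpoly α).map (algebraMap ℤ ℂ))).eq_prod_roots
  rw [leadingCoeff_map_of_injective (algebraMap ℤ ℂ).injective_int] at h
  rw [aroots_def]
  simp only [eq_intCast] at h
  rw [← h, coeff_map]
  simp only [eq_intCast]
  exact intCast_mem V _

/-- A product over all embeddings of a number field, in terms of the conjugates of an element. -/
lemma prod_embeddings_eq_prod_aroots_pow {k F E M : Type*} [Field k] [CharZero k] [Field F]
    [Algebra k F] [FiniteDimensional k F] [Field E] [IsAlgClosed E] [Algebra k E] [CommMonoid M]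
    (x : F) (g : E → M) :
    ∏ σ : F →ₐ[k] E, g (σ x) =
      (((minpoly k x).aroots E).map g).prod ^ Module.finrank k⟮x⟯ F := by
  classical
  have hx : IsIntegral k x := Algebra.IsIntegral.isIntegral x
  let pb := adjoin.powerBasis hx
  let : Fintype (k⟮x⟯ →ₐ[k] E) := PowerBasis.AlgHom.fintype pb
  have hgen : algebraMap k⟮x⟯ F pb.gen = x := by simp [pb]
  -- Embeddings are grouped by their restriction to `k⟮x⟯`; each restriction has `[F : k⟮x⟯]`
  -- extensions and corresponds to one root of the minimal polynomial.
  have h1 : ∏ σ : F →ₐ[k] E, g (σ x) =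
      (∏ τ : k⟮x⟯ →ₐ[k] E, g (τ pb.gen)) ^ Module.finrank k⟮x⟯ F := by
    rw [Fintype.prod_equiv algHomEquivSigma (fun σ : F →ₐ[k] E => g (σ x))
      (fun σ : Σ f : k⟮x⟯ →ₐ[k] E, @AlgHom k⟮x⟯ F E _ _ _ _ f.toRingHom.toAlgebra =>
        g (σ.1 pb.gen)),
      ← Finset.univ_sigma_univ, Finset.prod_sigma, ← Finset.prod_pow]
    · refine Finset.prod_congr rfl fun σ _ => ?_
      let : Algebra k⟮x⟯ E := σ.toRingHom.toAlgebra
      simp_rw [Finset.prod_const]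
      congr
      exact AlgHom.card k⟮x⟯ F E
    · intro σ
      conv_lhs => rw [← hgen]
      simp only [algHomEquivSigma, Equiv.coe_fn_mk, AlgHom.domRestrict, AlgHom.comp_apply,
        IsScalarTower.coe_toAlgHom']
  rw [h1]
  congr 1
  rw [Fintype.prod_equiv pb.liftEquiv' (fun τ => g (τ pb.gen)) (fun y => g y.1)
    (fun τ => by simp [PowerBasis.liftEquiv'_apply_coe])]
  have hmin : minpoly k pb.gen = minpoly k x := by
    rw [adjoin.powerBasis_gen, minpoly_gen]
  have hnd : ((minpoly k x).aroots E).Nodup :=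
    nodup_roots ((minpoly.irreducible hx).separable.map)
  rw [← hmin] at hnd ⊢
  rw [Finset.prod_mem_multiset _ (fun y => g y.1) g (fun _ => rfl), Finset.prod_eq_multiset_prod,
    Multiset.toFinset_val, Multiset.dedup_eq_self.mpr hnd]

lemma natDegree_minpoly_mul_finrank {k F : Type*} [Field k] [Field F]
    [Algebra k F] [FiniteDimensional k F] (x : F) :
    (minpoly k x).natDegree * Module.finrank k⟮x⟯ F = Module.finrank k F := by
  rw [← adjoin.finrank (Algebra.IsIntegral.isIntegral (R := k) x), Module.finrank_mul_finrank]

/-- The embeddings inducing the same absolute value as a given one `ι`: there are at least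
`[ℝ(ι x, ι y) : ℝ]` of them. -/
lemma exists_finset_embeddings_norm_eq {F : Type*} [Field F] [Algebra ℚ F]
    (ι : F →ₐ[ℚ] ℂ) (x y : F) :
    ∃ S : Finset (F →ₐ[ℚ] ℂ), S.card = Module.finrank ℝ ℝ⟮ι x, ι y⟯ ∧
      ∀ σ ∈ S, ∀ z, ‖σ z‖ = ‖ι z‖ := by
  classical
  let τ : F →ₐ[ℚ] ℂ := (Complex.conjAe.restrictScalars ℚ : ℂ →ₐ[ℚ] ℂ).comp ι
  have hτ : ∀ z, τ z = (starRingEnd ℂ) (ι z) := fun z => rfl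
  by_cases hreal : ℝ⟮ι x, ι y⟯ = ⊥
  · refine ⟨{ι}, ?_, by simp⟩
    rw [hreal, IntermediateField.finrank_bot, Finset.card_singleton]
  · refine ⟨{ι, τ}, ?_, ?_⟩
    · have hdiff : ι ≠ τ := by
        intro h
        apply hreal
        rw [eq_bot_iff, adjoin_le_iff]
        have key : ∀ z, ι z ∈ (⊥ : IntermediateField ℝ ℂ) := by
          intro z
          have h1 : (starRingEnd ℂ) (ι z) = ι z := by rw [← hτ, ← h]
          obtain ⟨r, hr⟩ := Complex.conj_eq_iff_real.1 h1
          rw [IntermediateField.mem_bot]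
          exact ⟨r, hr.symm⟩
        rintro z (rfl | rfl)
        · exact key x
        · exact key y
      rw [Finset.card_pair hdiff]
      have hdvd : Module.finrank ℝ ℝ⟮ι x, ι y⟯ ∣ 2 := by
        rw [← Complex.finrank_real_complex]
        exact ⟨_, (Module.finrank_mul_finrank ℝ ℝ⟮ι x, ι y⟯ ℂ).symm⟩
      rcases (Nat.dvd_prime Nat.prime_two).1 hdvd with h | h
      · exact absurd (IntermediateField.finrank_eq_one_iff.1 h) hreal
      · exact h.symm
    · intro σ hσ z
      rw [Finset.mem_insert, Finset.mem_singleton] at hσ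
      rcases hσ with rfl | rfl
      · rfl
      · rw [hτ, Complex.norm_conj]

/-! ### Liouville's inequality -/

section Liouville

variable {F : Type*} [Field F] [Algebra ℚ F] [FiniteDimensional ℚ F] (ι : F →ₐ[ℚ] ℂ)

/-- Each conjugate of `x` is taken by `[F : ℚ⟮x⟯]` embeddings, so the height can be computed in any
number field containing `x`. -/
lemma finrank_mul_weilHeight (x : F) :
    Module.finrank ℚ F * weilHeight (ι x) =
      Module.finrank ℚ⟮x⟯ F * Real.log |((intMinpoly (ι x)).leadingCoeff : ℝ)| +
        ∑ σ : F →ₐ[ℚ] ℂ, Real.log (max 1 ‖σ x‖) := by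
  have hx : IsIntegral ℚ x := Algebra.IsIntegral.isIntegral x
  have hιx : IsAlgebraic ℚ (ι x) := (hx.map ι).isAlgebraic
  have hmin : minpoly ℚ (ι x) = minpoly ℚ x := minpoly.algHom_eq ι ι.injective x
  -- The product formula is read additively through `Multiplicative`.
  have h := prod_embeddings_eq_prod_aroots_pow (k := ℚ) (E := ℂ) x
    (fun z => Multiplicative.ofAdd (Real.log (max 1 ‖z‖)))
  have h' : ∑ σ : F →ₐ[ℚ] ℂ, Real.log (max 1 ‖σ x‖) = Module.finrank ℚ⟮x⟯ F *
      (((minpoly ℚ x).aroots ℂ).map fun z => Real.log (max 1 ‖z‖)).sum := by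
    have h2 := congrArg Multiplicative.toAdd h
    rw [toAdd_prod, toAdd_pow, nsmul_eq_mul, toAdd_multiset_sum, Multiset.map_map] at h2
    exact h2
  rw [h', weilHeight, aroots_intMinpoly hιx, natDegree_intMinpoly hιx, hmin,
    ← natDegree_minpoly_mul_finrank (k := ℚ) x]
  have : ((minpoly ℚ x).natDegree : ℝ) ≠ 0 := by
    exact_mod_cast (minpoly.natDegree_pos hx).ne'
  push_cast
  field_simp

lemma valuation_sum_le (V : ValuationSubring ℂ) (p : ℕ → ℕ → ℤ) (M N : ℕ) (x y : ℂ) :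
    V.valuation (∑ k ∈ Finset.range (M + 1), ∑ l ∈ Finset.range (N + 1), p k l * y ^ k * x ^ l) ≤
      max 1 (V.valuation y) ^ M * max 1 (V.valuation x) ^ N := by
  refine Valuation.map_sum_le _ fun k hk => Valuation.map_sum_le _ fun l hl => ?_
  rw [map_mul, map_mul, map_pow, map_pow]
  have h1 : V.valuation (p k l : ℂ) ≤ 1 := (V.valuation_le_one_iff _).2 (intCast_mem V _)
  have hpow : ∀ (z : ℂ) (i n : ℕ), i < n + 1 → V.valuation z ^ i ≤ max 1 (V.valuation z) ^ n :=
    fun z i n hi => (pow_le_pow_left' (le_max_right _ _) i).trans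
      (pow_le_pow_right' (le_max_left _ _) (by omega))
  have h2 := mul_le_mul' (mul_le_mul' h1 (hpow y k M (Finset.mem_range.1 hk)))
    (hpow x l N (Finset.mem_range.1 hl))
  rwa [one_mul] at h2

/-- The leading coefficients clear the denominator of the norm of `Λ`. At every valuation ring the
ultrametric inequality bounds the conjugates of `Λ`, and Gauss's lemma absorbs the resulting maxima.
The product is thus a rational number integral over `ℤ`, and a nonzero integer has absolute value at
least `1`. -/
lemma one_le_leadingCoeff_pow_mul_prod_embeddings (x y : F) (p : ℕ → ℕ → ℤ) (M N : ℕ) (Λ : F)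
    (hΛ : Λ = ∑ k ∈ Finset.range (M + 1), ∑ l ∈ Finset.range (N + 1), p k l * y ^ k * x ^ l)
    (hΛ0 : Λ ≠ 0) :
    1 ≤ (|((intMinpoly (ι y)).leadingCoeff : ℝ)| ^ Module.finrank ℚ⟮y⟯ F) ^ M *
      (|((intMinpoly (ι x)).leadingCoeff : ℝ)| ^ Module.finrank ℚ⟮x⟯ F) ^ N *
        ∏ σ : F →ₐ[ℚ] ℂ, ‖σ Λ‖ := by
  have halg : ∀ z : F, IsAlgebraic ℚ (ι z) := fun z =>
    ((Algebra.IsIntegral.isIntegral (R := ℚ) z).map ι).isAlgebraic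
  have hmin : ∀ z : F, minpoly ℚ (ι z) = minpoly ℚ z := fun z =>
    minpoly.algHom_eq ι ι.injective z
  set a := (intMinpoly (ι x)).leadingCoeff with ha
  set b := (intMinpoly (ι y)).leadingCoeff with hb
  have ha0 : a ≠ 0 := leadingCoeff_ne_zero.2 (intMinpoly_ne_zero (halg x))
  have hb0 : b ≠ 0 := leadingCoeff_ne_zero.2 (intMinpoly_ne_zero (halg y))
  set q : ℚ := ((b : ℚ) ^ Module.finrank ℚ⟮y⟯ F) ^ M * ((a : ℚ) ^ Module.finrank ℚ⟮x⟯ F) ^ N *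
    Algebra.norm ℚ Λ with hq
  have hqC : (q : ℂ) = ((b : ℂ) ^ Module.finrank ℚ⟮y⟯ F) ^ M *
      ((a : ℂ) ^ Module.finrank ℚ⟮x⟯ F) ^ N * ∏ σ : F →ₐ[ℚ] ℂ, σ Λ := by
    rw [← Algebra.norm_eq_prod_embeddings ℚ ℂ Λ, hq]
    simp
  have hint : IsIntegral ℤ (q : ℂ) := by
    refine isIntegral_int_of_forall_valuationSubring fun V => ?_
    rw [← V.valuation_le_one_iff, hqC, map_mul, map_mul, map_pow, map_pow, map_pow, map_pow,
      map_prod]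
    have hσ : ∀ σ : F →ₐ[ℚ] ℂ, V.valuation (σ Λ) ≤
        max 1 (V.valuation (σ y)) ^ M * max 1 (V.valuation (σ x)) ^ N := by
      intro σ
      have := valuation_sum_le V p M N (σ x) (σ y)
      rw [hΛ]
      simpa using this
    have hP : ∀ z : F, V.valuation ((intMinpoly (ι z)).leadingCoeff : ℂ) ^ Module.finrank ℚ⟮z⟯ F *
        ∏ σ : F →ₐ[ℚ] ℂ, max 1 (V.valuation (σ z)) ≤ 1 := by
      intro z
      rw [prod_embeddings_eq_prod_aroots_pow (k := ℚ) z (fun w => max 1 (V.valuation w)),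
        ← mul_pow, ← hmin z]
      exact pow_le_one' (valuation_leadingCoeff_mul_prod_le_one (halg z) V) _
    calc _ ≤ (V.valuation (b : ℂ) ^ Module.finrank ℚ⟮y⟯ F) ^ M *
          (V.valuation (a : ℂ) ^ Module.finrank ℚ⟮x⟯ F) ^ N *
          ∏ σ : F →ₐ[ℚ] ℂ, (max 1 (V.valuation (σ y)) ^ M * max 1 (V.valuation (σ x)) ^ N) :=
          mul_le_mul' le_rfl (Finset.prod_le_prod' fun σ _ => hσ σ)
      _ = (V.valuation (b : ℂ) ^ Module.finrank ℚ⟮y⟯ F *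
            ∏ σ : F →ₐ[ℚ] ℂ, max 1 (V.valuation (σ y))) ^ M *
          (V.valuation (a : ℂ) ^ Module.finrank ℚ⟮x⟯ F *
            ∏ σ : F →ₐ[ℚ] ℂ, max 1 (V.valuation (σ x))) ^ N := by
          rw [Finset.prod_mul_distrib, Finset.prod_pow, Finset.prod_pow, mul_pow, mul_pow]
          exact mul_mul_mul_comm _ _ _ _
      _ ≤ 1 := mul_le_one' (pow_le_one' (hP y) _) (pow_le_one' (hP x) _)
  have hq0 : q ≠ 0 := by
    rw [hq]
    have := (Algebra.norm_ne_zero_iff (R := ℚ)).2 hΛ0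
    positivity
  have hintQ : IsIntegral ℤ q := by
    have : ((Rat.castHom ℂ).toIntAlgHom q) = (q : ℂ) := rfl
    rw [← this] at hint
    exact (isIntegral_algHom_iff _ (Rat.castHom ℂ).injective).1 hint
  obtain ⟨n, hn⟩ := IsIntegrallyClosed.isIntegral_iff.1 hintQ
  have hn0 : n ≠ 0 := by rintro rfl; exact hq0 (by simpa using hn.symm)
  have hnorm : ‖(q : ℂ)‖ = |(n : ℝ)| := by
    rw [← hn]; simp
  have hge : (1 : ℝ) ≤ |(n : ℝ)| := by exact_mod_cast Int.one_le_abs hn0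
  rw [← hnorm, hqC, norm_mul, norm_mul, norm_pow, norm_pow, norm_pow, norm_pow, norm_prod] at hge
  simpa using hge

lemma norm_sum_le_mul_max_pow (p : ℕ → ℕ → ℤ) (M N : ℕ) (x y : ℂ) :
    ‖∑ k ∈ Finset.range (M + 1), ∑ l ∈ Finset.range (N + 1), p k l * y ^ k * x ^ l‖ ≤
      (∑ k ∈ Finset.range (M + 1), ∑ l ∈ Finset.range (N + 1), |(p k l : ℝ)|) *
        (max 1 ‖y‖ ^ M * max 1 ‖x‖ ^ N) := by
  simp_rw [Finset.sum_mul]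
  refine norm_sum_le_of_le _ fun k hk => norm_sum_le_of_le _ fun l hl => ?_
  have hpow : ∀ (z : ℂ) (i n : ℕ), i < n + 1 → ‖z‖ ^ i ≤ max 1 ‖z‖ ^ n :=
    fun z i n hi => (pow_le_pow_left₀ (norm_nonneg _) (le_max_right _ _) i).trans
      (pow_le_pow_right₀ (le_max_left _ _) (by omega))
  rw [norm_mul, norm_mul, norm_pow, norm_pow, Complex.norm_intCast, mul_assoc]
  gcongr
  · exact hpow y k M (Finset.mem_range.1 hk)
  · exact hpow x l N (Finset.mem_range.1 hl)

/-- Liouville's inequality, with a distinguished set `S` of embeddings inducing the same absolute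
value as `ι`. -/
lemma liouville_inequality (x y : F) (p : ℕ → ℕ → ℤ) (M N : ℕ) (H : ℝ)
    (S : Finset (F →ₐ[ℚ] ℂ)) (hS : ∀ σ ∈ S, ∀ z, ‖σ z‖ = ‖ι z‖)
    (hH : ∑ k ∈ Finset.range (M + 1), ∑ l ∈ Finset.range (N + 1), |(p k l : ℝ)| ≤ H)
    (hne : ∑ k ∈ Finset.range (M + 1), ∑ l ∈ Finset.range (N + 1),
      p k l * ι y ^ k * ι x ^ l ≠ 0) :
    0 ≤ S.card * Real.log ‖∑ k ∈ Finset.range (M + 1), ∑ l ∈ Finset.range (N + 1),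
        p k l * ι y ^ k * ι x ^ l‖ +
      (Module.finrank ℚ F - S.card) * Real.log H +
      M * (Module.finrank ℚ F * weilHeight (ι y) - S.card * Real.log (max 1 ‖ι y‖)) +
      N * (Module.finrank ℚ F * weilHeight (ι x) - S.card * Real.log (max 1 ‖ι x‖)) := by
  classical
  set Λ : F := ∑ k ∈ Finset.range (M + 1), ∑ l ∈ Finset.range (N + 1), p k l * y ^ k * x ^ l
    with hΛ
  have hσΛ : ∀ σ : F →ₐ[ℚ] ℂ, σ Λ = ∑ k ∈ Finset.range (M + 1), ∑ l ∈ Finset.range (N + 1),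
      p k l * σ y ^ k * σ x ^ l := by
    intro σ
    simp [hΛ]
  rw [← hσΛ] at hne ⊢
  have hΛ0 : Λ ≠ 0 := by rintro h; exact hne (by rw [h, map_zero])
  have halg : ∀ z : F, IsAlgebraic ℚ (ι z) := fun z =>
    ((Algebra.IsIntegral.isIntegral (R := ℚ) z).map ι).isAlgebraic
  have hlc : ∀ z : F, |((intMinpoly (ι z)).leadingCoeff : ℝ)| ≠ 0 := fun z => by
    simpa using intMinpoly_ne_zero (halg z)
  have hσ0 : ∀ σ : F →ₐ[ℚ] ℂ, ‖σ Λ‖ ≠ 0 := fun σ => by simpa using hΛ0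
  have hprod := Real.log_nonneg
    (one_le_leadingCoeff_pow_mul_prod_embeddings ι x y p M N Λ hΛ hΛ0)
  rw [Real.log_mul (mul_ne_zero (pow_ne_zero _ (pow_ne_zero _ (hlc y)))
      (pow_ne_zero _ (pow_ne_zero _ (hlc x)))) (Finset.prod_ne_zero_iff.2 fun σ _ => hσ0 σ),
    Real.log_mul (pow_ne_zero _ (pow_ne_zero _ (hlc y))) (pow_ne_zero _ (pow_ne_zero _ (hlc x))),
    Real.log_pow, Real.log_pow, Real.log_pow, Real.log_pow,
    Real.log_prod fun σ _ => hσ0 σ] at hprod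
  have hbound : ∀ σ : F →ₐ[ℚ] ℂ, Real.log ‖σ Λ‖ ≤ Real.log H +
      (M * Real.log (max 1 ‖σ y‖) + N * Real.log (max 1 ‖σ x‖)) := by
    intro σ
    have h1 := norm_sum_le_mul_max_pow p M N (σ x) (σ y)
    rw [← hσΛ] at h1
    have hy : 0 < max 1 ‖σ y‖ := by positivity
    have hx : 0 < max 1 ‖σ x‖ := by positivity
    have h2 : ‖σ Λ‖ ≤ H * (max 1 ‖σ y‖ ^ M * max 1 ‖σ x‖ ^ N) := h1.trans (by gcongr)
    have hpos : 0 < ‖σ Λ‖ := (norm_nonneg _).lt_of_ne' (hσ0 σ)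
    have hHpos : 0 < H := by
      by_contra hle
      have : H * (max 1 ‖σ y‖ ^ M * max 1 ‖σ x‖ ^ N) ≤ 0 :=
        mul_nonpos_of_nonpos_of_nonneg (not_lt.1 hle) (by positivity)
      linarith
    have h3 := Real.log_le_log hpos h2
    rwa [Real.log_mul hHpos.ne' (by positivity), Real.log_mul (by positivity) (by positivity),
      Real.log_pow, Real.log_pow] at h3
  have hcard : (Finset.univ \ S).card = (Module.finrank ℚ F : ℝ) - S.card := by
    have h1 := Finset.card_sdiff_add_card_eq_card (Finset.subset_univ S)
    rw [Finset.card_univ, AlgHom.card] at h1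
    rw [← h1]; push_cast; ring
  have hsplit : ∀ f : (F →ₐ[ℚ] ℂ) → ℝ,
      ∑ σ, f σ = ∑ σ ∈ Finset.univ \ S, f σ + ∑ σ ∈ S, f σ := fun f =>
    (Finset.sum_sdiff (Finset.subset_univ S)).symm
  have hconst : ∀ z, ∀ g : ℝ → ℝ, ∑ σ ∈ S, g ‖σ z‖ = S.card * g ‖ι z‖ := by
    intro z g
    rw [Finset.sum_congr rfl fun σ hσ => by rw [hS σ hσ z], Finset.sum_const, nsmul_eq_mul]
  -- Only embeddings outside `S` are estimated; each one in `S` contributes exactly `log ‖ι Λ‖`.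
  -- This yields the factor `[F : ℚ] - |S|` of `log H` and the subtracted terms beside the heights.
  have hΛsum := Finset.sum_le_sum (s := Finset.univ \ S) fun σ _ => hbound σ
  rw [Finset.sum_add_distrib, Finset.sum_add_distrib, ← Finset.mul_sum, ← Finset.mul_sum,
    Finset.sum_const, nsmul_eq_mul, hcard] at hΛsum
  rw [finrank_mul_weilHeight, finrank_mul_weilHeight]
  rw [hsplit, hconst Λ Real.log] at hprod
  rw [hsplit fun σ => Real.log (max 1 ‖σ x‖), hsplit fun σ => Real.log (max 1 ‖σ y‖),
    hconst x fun r => Real.log (max 1 r), hconst y fun r => Real.log (max 1 r)]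
  linarith

/-- This is what makes the degree ratio `D` at least `1`: the distinguished embeddings are among the
`[F : ℚ]` embeddings of `F`. -/
lemma finrank_real_adjoin_le (x y : F) :
    Module.finrank ℝ ℝ⟮ι x, ι y⟯ ≤ Module.finrank ℚ F := by
  obtain ⟨S, hcard, -⟩ := exists_finset_embeddings_norm_eq ι x y
  rw [← hcard, ← AlgHom.card ℚ F ℂ]
  exact Finset.card_le_univ S

lemma liouville_inequality_div_finrank (x y : F) (p : ℕ → ℕ → ℤ) (M N : ℕ) (H : ℝ)
    (hH : ∑ k ∈ Finset.range (M + 1), ∑ l ∈ Finset.range (N + 1), |(p k l : ℝ)| ≤ H)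
    (hne : ∑ k ∈ Finset.range (M + 1), ∑ l ∈ Finset.range (N + 1),
      p k l * ι y ^ k * ι x ^ l ≠ 0) (D : ℝ)
    (hD : D = (Module.finrank ℚ F : ℝ) / Module.finrank ℝ ℝ⟮ι x, ι y⟯) :
    0 ≤ Real.log ‖∑ k ∈ Finset.range (M + 1), ∑ l ∈ Finset.range (N + 1),
        p k l * ι y ^ k * ι x ^ l‖ + (D - 1) * Real.log H +
      M * (D * weilHeight (ι y) - Real.log (max 1 ‖ι y‖)) +
      N * (D * weilHeight (ι x) - Real.log (max 1 ‖ι x‖)) := by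
  obtain ⟨S, hcard, hS⟩ := exists_finset_embeddings_norm_eq ι x y
  have hpos : (0 : ℝ) < Module.finrank ℝ ℝ⟮ι x, ι y⟯ := by
    exact_mod_cast Module.finrank_pos (R := ℝ) (M := ℝ⟮ι x, ι y⟯)
  have h := liouville_inequality ι x y p M N H S hS hH hne
  rw [hcard] at h
  refine (div_nonneg h hpos.le).trans_eq ?_
  rw [hD]
  field_simp

end Liouville

lemma finiteDimensional_adjoin_pair {α β : ℂ} (hα : IsAlgebraic ℚ α) (hβ : IsAlgebraic ℚ β) :
    FiniteDimensional ℚ ℚ⟮α, β⟯ :=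
  finiteDimensional_adjoin fun z hz => by
    rcases hz with rfl | rfl
    · exact hα.isIntegral
    · exact hβ.isIntegral

lemma one_le_degreeRatio {α β : ℂ} (hα : IsAlgebraic ℚ α) (hβ : IsAlgebraic ℚ β) :
    1 ≤ degreeRatio α β := by
  have := finiteDimensional_adjoin_pair hα hβ
  have h1 := finrank_real_adjoin_le (ℚ⟮α, β⟯).val ⟨α, subset_adjoin _ _ (by simp)⟩
    ⟨β, subset_adjoin _ _ (by simp)⟩
  have hpos : 0 < Module.finrank ℝ ℝ⟮α, β⟯ := Module.finrank_pos
  rw [degreeRatio, one_le_div (by exact_mod_cast hpos)]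
  exact_mod_cast h1

lemma liouville_inequality_degreeRatio {α β : ℂ} (hα : IsAlgebraic ℚ α) (hβ : IsAlgebraic ℚ β)
    (p : ℕ → ℕ → ℤ) (M N : ℕ) (H : ℝ)
    (hH : ∑ k ∈ Finset.range (M + 1), ∑ l ∈ Finset.range (N + 1), |(p k l : ℝ)| ≤ H)
    (hne : ∑ k ∈ Finset.range (M + 1), ∑ l ∈ Finset.range (N + 1), p k l * β ^ k * α ^ l ≠ 0) :
    0 ≤ Real.log ‖∑ k ∈ Finset.range (M + 1), ∑ l ∈ Finset.range (N + 1),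
        p k l * β ^ k * α ^ l‖ + (degreeRatio α β - 1) * Real.log H +
      M * (degreeRatio α β * weilHeight β - Real.log (max 1 ‖β‖)) +
      N * (degreeRatio α β * weilHeight α - Real.log (max 1 ‖α‖)) := by
  have := finiteDimensional_adjoin_pair hα hβ
  exact liouville_inequality_div_finrank (ℚ⟮α, β⟯).val ⟨α, subset_adjoin _ _ (by simp)⟩
    ⟨β, subset_adjoin _ _ (by simp)⟩ p M N H hH hne (degreeRatio α β) rfl

/-! ### Sums of residues of rational functions -/

noncomputable section

/-- The power series `(1 + X / a)⁻¹`. -/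
def geomSeries (a : ℚ) : PowerSeries ℚ := PowerSeries.mk fun i => (-a⁻¹) ^ i

lemma one_add_mul_geomSeries (a : ℚ) :
    (1 + PowerSeries.C a⁻¹ * PowerSeries.X) * geomSeries a = 1 := by
  ext n
  rw [add_mul, one_mul, mul_assoc, map_add, PowerSeries.coeff_C_mul]
  cases n with
  | zero => simp [geomSeries]
  | succ n =>
    rw [PowerSeries.coeff_succ_X_mul, geomSeries, PowerSeries.coeff_mk, PowerSeries.coeff_mk,
      PowerSeries.coeff_one, if_neg n.succ_ne_zero, pow_succ]
    ring

/-- The power series `(X + a)⁻¹`. -/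
def invLinear (a : ℚ) : PowerSeries ℚ := PowerSeries.C a⁻¹ * geomSeries a

lemma X_add_C_mul_invLinear {a : ℚ} (ha : a ≠ 0) :
    (PowerSeries.X + PowerSeries.C a) * invLinear a = 1 := by
  have h : (PowerSeries.X + PowerSeries.C a) * PowerSeries.C a⁻¹ =
      1 + PowerSeries.C a⁻¹ * PowerSeries.X := by
    rw [add_mul, ← map_mul, mul_inv_cancel₀ ha, map_one]
    ring
  rw [invLinear, ← mul_assoc, h, one_add_mul_geomSeries]

/-- The expansion at `l` of `∏ (ζ - m) ^ (-n m)` over `m < L`, `m ≠ l`, in the variable `ζ - l`. -/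
def localFactor (L : ℕ) (n : ℕ → ℕ) (l : ℕ) : PowerSeries ℚ :=
  ∏ m ∈ (Finset.range L).erase l, invLinear ((l : ℚ) - m) ^ n m

/-- The sum of the residues of `f(ζ) / ∏ (ζ - m) ^ n m` at its poles `l < L`. -/
def residueSum (L : ℕ) (n : ℕ → ℕ) (f : ℚ[X]) : ℚ :=
  ∑ l ∈ Finset.range L,
    PowerSeries.coeff (n l) (PowerSeries.X * (taylor (l : ℚ) f : PowerSeries ℚ) * localFactor L n l)

lemma residueSum_add (L : ℕ) (n : ℕ → ℕ) (f g : ℚ[X]) :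
    residueSum L n (f + g) = residueSum L n f + residueSum L n g := by
  simp [residueSum, mul_add, add_mul, Finset.sum_add_distrib]

lemma residueSum_C_mul (L : ℕ) (n : ℕ → ℕ) (c : ℚ) (f : ℚ[X]) :
    residueSum L n (C c * f) = c * residueSum L n f := by
  rw [residueSum, residueSum, Finset.mul_sum]
  refine Finset.sum_congr rfl fun l _ => ?_
  rw [taylor_mul, taylor_C, Polynomial.coe_mul, Polynomial.coe_C, ← PowerSeries.coeff_C_mul]
  congr 1
  ring

lemma localFactor_add_single_self (L : ℕ) (n : ℕ → ℕ) (j : ℕ) :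
    localFactor L (n + Pi.single j 1) j = localFactor L n j := by
  refine Finset.prod_congr rfl fun m hm => ?_
  rw [Pi.add_apply, Pi.single_eq_of_ne (Finset.ne_of_mem_erase hm), add_zero]

lemma localFactor_add_single_of_ne {L : ℕ} (n : ℕ → ℕ) {j l : ℕ} (hj : j < L) (hl : l ≠ j) :
    localFactor L (n + Pi.single j 1) l = invLinear ((l : ℚ) - j) * localFactor L n l := by
  have hmem : j ∈ (Finset.range L).erase l := by simp [hj, hl.symm]
  rw [localFactor, localFactor, ← Finset.mul_prod_erase _ _ hmem,
    ← Finset.mul_prod_erase _ _ hmem, Pi.add_apply, Pi.single_eq_same, pow_succ', mul_assoc]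
  congr 2
  refine Finset.prod_congr rfl fun m hm => ?_
  rw [Pi.add_apply, Pi.single_eq_of_ne (Finset.ne_of_mem_erase hm), add_zero]

/-- Multiplying numerator and denominator by `ζ - j` changes nothing. At the pole `j` the new factor
is `X` and the order rises by one; at any other pole it cancels against an `invLinear`. -/
lemma residueSum_add_single {L : ℕ} (n : ℕ → ℕ) {j : ℕ} (hj : j < L) (f : ℚ[X]) :
    residueSum L (n + Pi.single j 1) ((X - C (j : ℚ)) * f) = residueSum L n f := by
  refine Finset.sum_congr rfl fun l _ => ?_
  have ht : ((taylor (l : ℚ) ((X - C (j : ℚ)) * f) : ℚ[X]) : PowerSeries ℚ) =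
      (PowerSeries.X + PowerSeries.C ((l : ℚ) - j)) * (taylor (l : ℚ) f : PowerSeries ℚ) := by
    rw [taylor_mul, map_sub, taylor_X, taylor_C, add_sub_assoc, ← C_sub, Polynomial.coe_mul,
      Polynomial.coe_add, Polynomial.coe_X, Polynomial.coe_C]
  rw [ht]
  by_cases hl : l = j
  · subst hl
    rw [localFactor_add_single_self, sub_self, map_zero, add_zero, Pi.add_apply,
      Pi.single_eq_same, mul_assoc, PowerSeries.coeff_succ_X_mul]
  · rw [localFactor_add_single_of_ne n hj hl, Pi.add_apply, Pi.single_eq_of_ne hl, add_zero]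
    have h0 : (l : ℚ) - j ≠ 0 := sub_ne_zero.2 (by exact_mod_cast hl)
    congr 1
    calc _ = PowerSeries.X * (taylor (l : ℚ) f : PowerSeries ℚ) *
          (((PowerSeries.X + PowerSeries.C ((l : ℚ) - j)) * invLinear ((l : ℚ) - j)) *
            localFactor L n l) := by ring
      _ = _ := by rw [X_add_C_mul_invLinear h0, one_mul]

lemma exists_eq_add_single {n : ℕ → ℕ} {j : ℕ} (hj : n j ≠ 0) :
    ∃ n' : ℕ → ℕ, n = n' + Pi.single j 1 := by
  refine ⟨Function.update n j (n j - 1), ?_⟩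
  ext m
  by_cases hm : m = j
  · subst hm
    simp; omega
  · simp [hm]

lemma sum_add_single {L j : ℕ} (hj : j < L) (n : ℕ → ℕ) :
    ∑ m ∈ Finset.range L, (n + Pi.single j 1 : ℕ → ℕ) m = ∑ m ∈ Finset.range L, n m + 1 := by
  simp [Finset.sum_add_distrib, hj]

lemma residueSum_one_of_support {L : ℕ} (n : ℕ → ℕ) {j : ℕ} (hj : j < L)
    (hn : ∀ m < L, m ≠ j → n m = 0) : residueSum L n 1 = if n j = 1 then 1 else 0 := by
  rw [residueSum, Finset.sum_eq_single_of_mem j (Finset.mem_range.2 hj)]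
  · have : localFactor L n j = 1 := by
      refine Finset.prod_eq_one fun m hm => ?_
      rw [Finset.mem_erase, Finset.mem_range] at hm
      rw [hn m hm.2 hm.1, pow_zero]
    rw [this]
    simp [PowerSeries.coeff_X]
  -- With exponent `0` there is no pole; the extra factor `X` in `residueSum` makes the coefficient
  -- read there vanish.
  · intro l hl hlj
    rw [hn l (Finset.mem_range.1 hl) hlj, mul_assoc, PowerSeries.coeff_zero_X_mul]

lemma residueSum_one {L : ℕ} (N : ℕ) : ∀ n : ℕ → ℕ, ∑ m ∈ Finset.range L, n m = N + 1 →
    residueSum L n 1 = if N = 0 then 1 else 0 := by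
  induction N with
  | zero =>
    intro n hn
    obtain ⟨j, hj, hnj⟩ : ∃ j ∈ Finset.range L, n j ≠ 0 := by
      by_contra! h
      rw [Finset.sum_eq_zero h] at hn
      omega
    rw [← Finset.add_sum_erase _ _ hj] at hn
    have hz : ∑ m ∈ (Finset.range L).erase j, n m = 0 := by omega
    rw [Finset.sum_eq_zero_iff] at hz
    rw [residueSum_one_of_support n (Finset.mem_range.1 hj)
      fun m hm hmj => hz m (by simp [hm, hmj]), if_pos (by omega), if_pos rfl]
  | succ N ih =>
    intro n hn
    obtain ⟨j, hj, hnj⟩ : ∃ j ∈ Finset.range L, n j ≠ 0 := by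
      by_contra! h
      rw [Finset.sum_eq_zero h] at hn
      omega
    by_cases hz : ∀ m < L, m ≠ j → n m = 0
    · rw [residueSum_one_of_support n (Finset.mem_range.1 hj) hz, if_neg, if_neg N.succ_ne_zero]
      rw [Finset.sum_eq_single_of_mem j hj fun m hm hmj => hz m (Finset.mem_range.1 hm) hmj] at hn
      omega
    · push Not at hz
      obtain ⟨i, hi, hij, hni⟩ := hz
      rw [Finset.mem_range] at hj
      obtain ⟨n₁, rfl⟩ := exists_eq_add_single hnj
      obtain ⟨n₂, h₂⟩ := exists_eq_add_single hni
      have h1 := residueSum_add_single n₁ hj 1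
      have h2 := residueSum_add_single n₂ hi 1
      rw [← h₂] at h2
      have hs1 := sum_add_single hj n₁
      have hs2 := sum_add_single hi n₂
      rw [← h₂] at hs2
      rw [ih n₁ (by omega)] at h1
      rw [ih n₂ (by omega)] at h2
      -- With two distinct poles, `1 = ((ζ - j) - (ζ - i)) / (i - j)` expresses the sum as a
      -- difference of two sums of smaller total order, which are equal by induction.
      have hne : (i : ℚ) - j ≠ 0 := sub_ne_zero.2 (by exact_mod_cast hij)
      have hone : (1 : ℚ[X]) = C ((i : ℚ) - j)⁻¹ * ((X - C (j : ℚ)) * 1 +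
          C (-1) * ((X - C (i : ℚ)) * 1)) := by
        have : (X - C (j : ℚ)) * 1 + C (-1) * ((X - C (i : ℚ)) * 1) = C ((i : ℚ) - j) := by
          simp only [map_neg, map_one, map_sub]
          ring
        rw [this, ← C_mul, inv_mul_cancel₀ hne, C_1]
      rw [hone, residueSum_C_mul, residueSum_add, residueSum_C_mul, h1, h2, if_neg N.succ_ne_zero]
      ring

/-- The residues of a rational function that is `O(ζ⁻²)` at infinity add up to zero. -/
lemma residueSum_eq_zero {L : ℕ} (d : ℕ) : ∀ (n : ℕ → ℕ) (f : ℚ[X]), f.natDegree ≤ d →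
    d + 2 ≤ ∑ m ∈ Finset.range L, n m → residueSum L n f = 0 := by
  induction d with
  | zero =>
    intro n f hf hn
    rw [eq_C_of_natDegree_le_zero hf, ← mul_one (C _), residueSum_C_mul,
      residueSum_one (∑ m ∈ Finset.range L, n m - 1) n (by omega), if_neg (by omega), mul_zero]
  | succ d ih =>
    intro n f hf hn
    obtain ⟨j, hj, hnj⟩ : ∃ j ∈ Finset.range L, n j ≠ 0 := by
      by_contra! h
      rw [Finset.sum_eq_zero h] at hn
      omega
    rw [Finset.mem_range] at hj
    have hone : residueSum L n 1 = 0 := by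
      rw [residueSum_one (∑ m ∈ Finset.range L, n m - 1) n (by omega), if_neg (by omega)]
    obtain ⟨n', rfl⟩ := exists_eq_add_single hnj
    have hsum := sum_add_single hj n'
    -- Division by `ζ - j` lowers the degree and the total order by one each; the constant remainder
    -- is covered by `residueSum_one`.
    have hf' : f = (X - C (j : ℚ)) * (f /ₘ (X - C (j : ℚ))) + C (f.eval (j : ℚ)) * 1 := by
      rw [mul_one, add_comm, ← modByMonic_X_sub_C_eq_C_eval,
        modByMonic_add_div f (X - C (j : ℚ))]
    rw [hf', residueSum_add, residueSum_C_mul, hone, residueSum_add_single n' hj, mul_zero,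
      add_zero]
    refine ih n' _ ?_ (by omega)
    rw [natDegree_divByMonic _ (monic_X_sub_C _), natDegree_X_sub_C]
    omega


/-! ### Partial fractions and Hermite–Padé forms -/

lemma coe_sum_powerSeries {ι : Type*} (s : Finset ι) (f : ι → ℚ[X]) :
    ((∑ i ∈ s, f i : ℚ[X]) : PowerSeries ℚ) = ∑ i ∈ s, (f i : PowerSeries ℚ) :=
  map_sum Polynomial.coeToPowerSeries.ringHom f s

/-- The coefficient of `(ζ - l) ^ (-s - 1)` in the partial fraction expansion of
`∏ (ζ - m) ^ (-n m)`. -/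
def partialFractionCoeff (L : ℕ) (n : ℕ → ℕ) (l s : ℕ) : ℚ :=
  PowerSeries.coeff (n l) (PowerSeries.X ^ (s + 1) * localFactor L n l)

lemma partialFractionCoeff_of_le (L : ℕ) {n : ℕ → ℕ} {l s : ℕ} (h : n l ≤ s) :
    partialFractionCoeff L n l s = 0 := by
  rw [partialFractionCoeff, PowerSeries.coeff_X_pow_mul', if_neg (by omega)]

/-- Expanding `ζ^i` in powers of `ζ - l` pairs `(ζ - l)^s` with the polar term `(ζ - l)^(-s-1)`. -/
lemma residueSum_X_pow (L : ℕ) (n : ℕ → ℕ) (i : ℕ) :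
    residueSum L n (X ^ i) = ∑ l ∈ Finset.range L, ∑ s ∈ Finset.range (i + 1),
      partialFractionCoeff L n l s * ((l : ℚ) ^ (i - s) * i.choose s) := by
  refine Finset.sum_congr rfl fun l _ => ?_
  rw [taylor_pow, taylor_X, add_pow, coe_sum_powerSeries, Finset.mul_sum, Finset.sum_mul,
    map_sum]
  refine Finset.sum_congr rfl fun s _ => ?_
  rw [partialFractionCoeff, mul_comm _ ((l : ℚ) ^ (i - s) * _), ← PowerSeries.coeff_C_mul]
  congr 1
  rw [← C_eq_natCast]
  simp only [Polynomial.coe_mul, Polynomial.coe_pow, Polynomial.coe_X, Polynomial.coe_C, map_mul,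
    map_pow]
  ring

/-- The exponents `M, …, M, M + 1, M, …, M`, with `M + 1` in position `j`. -/
def padeExponent (M j : ℕ) : ℕ → ℕ := (fun _ => M) + Pi.single j 1

lemma padeExponent_self (M j : ℕ) : padeExponent M j j = M + 1 := by simp [padeExponent]

lemma padeExponent_of_ne (M : ℕ) {j l : ℕ} (h : l ≠ j) : padeExponent M j l = M := by
  simp [padeExponent, h]

lemma padeExponent_le (M j l : ℕ) : padeExponent M j l ≤ M + 1 := by
  by_cases h : l = j
  · rw [h, padeExponent_self]
  · rw [padeExponent_of_ne M h]; omega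

lemma sum_padeExponent {L j : ℕ} (M : ℕ) (hj : j < L) :
    ∑ m ∈ Finset.range L, padeExponent M j m = M * L + 1 := by
  rw [padeExponent, sum_add_single hj]
  simp [mul_comm]

/-- The coefficient of `z ^ s * exp (l * z)` in the `j`-th Hermite–Padé form for the functions
`exp (l * z)`, `l < L`. -/
def padeCoeff (M L j s l : ℕ) : ℚ :=
  partialFractionCoeff L (padeExponent M j) l s / s.factorial

/-- The Taylor coefficients of the `j`-th Hermite–Padé form vanish up to order `M * L`. -/
lemma sum_padeCoeff_eq_zero {M L j i : ℕ} (hj : j < L) (hi : i < M * L) :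
    ∑ l ∈ Finset.range L, ∑ s ∈ Finset.range (M + 1), padeCoeff M L j s l *
      (if s ≤ i then (l : ℚ) ^ (i - s) / (i - s).factorial else 0) = 0 := by
  have hres : residueSum L (padeExponent M j) (X ^ i) = 0 := by
    refine residueSum_eq_zero i _ _ (by simp) ?_
    rw [sum_padeExponent M hj]
    omega
  have key : residueSum L (padeExponent M j) (X ^ i) = i.factorial *
      ∑ l ∈ Finset.range L, ∑ s ∈ Finset.range (M + 1), padeCoeff M L j s l *
        (if s ≤ i then (l : ℚ) ^ (i - s) / (i - s).factorial else 0) := by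
    rw [residueSum_X_pow, Finset.mul_sum]
    refine Finset.sum_congr rfl fun l _ => ?_
    rw [Finset.mul_sum]
    have hterm : ∀ s ∈ Finset.range (i + 1), partialFractionCoeff L (padeExponent M j) l s *
        ((l : ℚ) ^ (i - s) * i.choose s) = i.factorial * (padeCoeff M L j s l *
          (if s ≤ i then (l : ℚ) ^ (i - s) / (i - s).factorial else 0)) := by
      intro s hs
      have hsi : s ≤ i := Nat.lt_succ_iff.1 (Finset.mem_range.1 hs)
      rw [if_pos hsi, padeCoeff, Nat.cast_choose ℚ hsi]
      ring
    rw [Finset.sum_congr rfl hterm]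
    -- The ranges `s ≤ i` and `s ≤ M` give the same sum: beyond `i` the conditional is `0`, and
    -- beyond `M` the pole, of order at most `M + 1`, has no such term.
    have hbig : ∀ a, a = i + 1 ∨ a = M + 1 → ∑ s ∈ Finset.range a, (i.factorial : ℚ) *
          (padeCoeff M L j s l * (if s ≤ i then (l : ℚ) ^ (i - s) / (i - s).factorial else 0)) =
        ∑ s ∈ Finset.range (i + M + 2), (i.factorial : ℚ) *
          (padeCoeff M L j s l *
            (if s ≤ i then (l : ℚ) ^ (i - s) / (i - s).factorial else 0)) := by
      intro a ha
      refine Finset.sum_subset (Finset.range_mono (by omega)) fun s _ hs => ?_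
      rw [Finset.mem_range, not_lt] at hs
      rcases ha with rfl | rfl
      · rw [if_neg (by omega)]; ring
      · rw [padeCoeff, partialFractionCoeff_of_le L ((padeExponent_le M j l).trans hs)]; ring
    rw [hbig _ (Or.inl rfl), hbig _ (Or.inr rfl)]
  rw [key] at hres
  exact (mul_eq_zero.1 hres).resolve_left (by exact_mod_cast i.factorial_ne_zero)

lemma constantCoeff_localFactor_ne_zero {L : ℕ} (n : ℕ → ℕ) (l : ℕ) :
    PowerSeries.constantCoeff (localFactor L n l) ≠ 0 := by
  rw [localFactor, map_prod]
  refine Finset.prod_ne_zero_iff.2 fun m hm => ?_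
  rw [map_pow]
  refine pow_ne_zero _ ?_
  have h0 : (l : ℚ) - m ≠ 0 :=
    sub_ne_zero.2 (by exact_mod_cast (Finset.ne_of_mem_erase hm).symm)
  intro h
  have := congrArg PowerSeries.constantCoeff (X_add_C_mul_invLinear h0)
  rw [map_mul, h, mul_zero, map_one] at this
  exact zero_ne_one this

/-- Degree `M` is attained only at `l = j`, where the pole has order `M + 1`; the other poles have
order `M`. Hence the leading coefficients form an invertible diagonal matrix. -/
lemma padeCoeff_top_self (M L j : ℕ) : padeCoeff M L j M j ≠ 0 := by
  rw [padeCoeff, partialFractionCoeff, padeExponent_self, PowerSeries.coeff_X_pow_mul',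
    if_pos le_rfl, Nat.sub_self, PowerSeries.coeff_zero_eq_constantCoeff_apply]
  exact div_ne_zero (constantCoeff_localFactor_ne_zero _ _)
    (by exact_mod_cast M.factorial_ne_zero)

lemma padeCoeff_top_of_ne (M L : ℕ) {j l : ℕ} (h : l ≠ j) : padeCoeff M L j M l = 0 := by
  rw [padeCoeff, partialFractionCoeff_of_le L (padeExponent_of_ne M h).le, zero_div]

/-- The polynomial multiplying `exp (l * z)` in the `j`-th Hermite–Padé form. -/
def padePolynomial (M L j l : ℕ) : ℚ[X] :=
  ∑ s ∈ Finset.range (M + 1), monomial s (padeCoeff M L j s l)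

lemma coeff_padePolynomial (M L j l s : ℕ) :
    (padePolynomial M L j l).coeff s = if s < M + 1 then padeCoeff M L j s l else 0 := by
  simp [padePolynomial, coeff_monomial]

lemma natDegree_padePolynomial_le (M L j l : ℕ) : (padePolynomial M L j l).natDegree ≤ M :=
  natDegree_le_iff_coeff_eq_zero.2 fun s hs => by
    rw [coeff_padePolynomial, if_neg (by omega)]

lemma X_pow_dvd_sum_padePolynomial (M L : ℕ) {j : ℕ} (hj : j < L) :
    (PowerSeries.X : PowerSeries ℚ) ^ (M * L) ∣ ∑ l ∈ Finset.range L,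
      (padePolynomial M L j l : PowerSeries ℚ) *
        PowerSeries.rescale (l : ℚ) (PowerSeries.exp ℚ) := by
  rw [PowerSeries.X_pow_dvd_iff]
  intro i hi
  rw [← sum_padeCoeff_eq_zero hj hi, map_sum]
  refine Finset.sum_congr rfl fun l _ => ?_
  rw [padePolynomial, coe_sum_powerSeries, Finset.sum_mul, map_sum]
  refine Finset.sum_congr rfl fun s _ => ?_
  rw [Polynomial.coe_monomial, PowerSeries.monomial_eq_C_mul_X_pow, mul_assoc,
    PowerSeries.coeff_C_mul, PowerSeries.coeff_X_pow_mul']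
  split_ifs with h
  · rw [PowerSeries.coeff_rescale, PowerSeries.coeff_exp]
    simp [div_eq_mul_inv]
  · rfl

/-! ### Nonvanishing of the determinant -/

/-- The matrix of the Hermite–Padé forms. -/
def padeMatrix (M L : ℕ) : Matrix (Fin L) (Fin L) ℚ[X] :=
  Matrix.of fun j l => padePolynomial M L j l

lemma coeff_prod_perm_padeMatrix (M L : ℕ) (σ : Equiv.Perm (Fin L)) :
    (∏ i, padeMatrix M L (σ i) i).coeff (M * L) = ∏ i, (padeMatrix M L (σ i) i).coeff M := by
  have h := coeff_prod_of_natDegree_le Finset.univ (fun i => padeMatrix M L (σ i) i) M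
    fun i _ => natDegree_padePolynomial_le M L _ _
  rw [Finset.card_univ, Fintype.card_fin, mul_comm] at h
  exact h

lemma coeff_det_padeMatrix_ne_zero (M L : ℕ) : (padeMatrix M L).det.coeff (M * L) ≠ 0 := by
  rw [Matrix.det_apply, finsetSum_coeff, Finset.sum_eq_single_of_mem 1 (Finset.mem_univ _)]
  · rw [Equiv.Perm.sign_one, one_smul, coeff_prod_perm_padeMatrix]
    refine Finset.prod_ne_zero_iff.2 fun i _ => ?_
    simpa [padeMatrix, coeff_padePolynomial] using padeCoeff_top_self M L i
  · intro σ _ hσ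
    obtain ⟨i, hi⟩ : ∃ i, σ i ≠ i := by
      by_contra! h
      exact hσ (Equiv.ext h)
    rw [coeff_smul, coeff_prod_perm_padeMatrix, Finset.prod_eq_zero (Finset.mem_univ i), smul_zero]
    rw [padeMatrix, Matrix.of_apply, coeff_padePolynomial, if_pos (by omega)]
    exact padeCoeff_top_of_ne M L fun h => hi (Fin.ext h.symm)

lemma natDegree_det_padeMatrix_le (M L : ℕ) : (padeMatrix M L).det.natDegree ≤ M * L := by
  rw [Matrix.det_apply]
  refine natDegree_sum_le_of_forall_le _ _ fun σ _ => (natDegree_smul_le _ _).trans ?_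
  refine (natDegree_prod_le _ _).trans
    ((Finset.sum_le_sum fun i _ => natDegree_padePolynomial_le M L _ _).trans ?_)
  simp [mul_comm]

/-- Cramer's rule: applying the adjugate to the vector of forms, each divisible by `X^(ML)`, gives
the determinant times the vector of the `exp (l z)`, whose entry at `l = 0` is `1`. -/
lemma X_pow_dvd_det_padeMatrix {M L : ℕ} (hL : 0 < L) :
    (PowerSeries.X : PowerSeries ℚ) ^ (M * L) ∣ ((padeMatrix M L).det : PowerSeries ℚ) := by
  let B : Matrix (Fin L) (Fin L) (PowerSeries ℚ) := 
    (padeMatrix M L).map Polynomial.coeToPowerSeries.ringHom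
  let e : Fin L → PowerSeries ℚ := fun l =>
    PowerSeries.rescale ((l : ℕ) : ℚ) (PowerSeries.exp ℚ)
  have hdet : ((padeMatrix M L).det : PowerSeries ℚ) = B.det :=
    RingHom.map_det Polynomial.coeToPowerSeries.ringHom (padeMatrix M L)
  have he0 : e ⟨0, hL⟩ = 1 := by simp [e]
  have hB : ∀ j, (PowerSeries.X : PowerSeries ℚ) ^ (M * L) ∣ (B.mulVec e) j := by
    intro j
    have h := X_pow_dvd_sum_padePolynomial M L j.2
    rw [Finset.sum_range] at h
    exact h
  have hadj : B.det = ((B.adjugate).mulVec (B.mulVec e)) ⟨0, hL⟩ := by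
    rw [Matrix.mulVec_mulVec, Matrix.adjugate_mul, Matrix.smul_mulVec, Matrix.one_mulVec,
      Pi.smul_apply, he0, smul_eq_mul, mul_one]
  rw [hdet, hadj, Matrix.mulVec, dotProduct]
  exact Finset.dvd_sum fun j _ => Dvd.dvd.mul_left (hB j) _

lemma det_padeMatrix {M L : ℕ} (hL : 0 < L) :
    ∃ c : ℚ, c ≠ 0 ∧ (padeMatrix M L).det = C c * X ^ (M * L) := by
  refine ⟨_, coeff_det_padeMatrix_ne_zero M L, ?_⟩
  ext i
  rw [coeff_C_mul_X_pow]
  split_ifs with h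
  · rw [h]
  · rcases lt_or_gt_of_ne h with h | h
    · have := PowerSeries.X_pow_dvd_iff.1 (X_pow_dvd_det_padeMatrix hL) i h
      rwa [Polynomial.coeff_coe] at this
    · exact coeff_eq_zero_of_natDegree_lt ((natDegree_det_padeMatrix_le M L).trans_lt h)

/-- At any point `(β, α)` with `β ≠ 0`, some Hermite–Padé form does not vanish. -/
lemma exists_pade_form_ne_zero {M L : ℕ} (hL : 0 < L) (α : ℂ) {β : ℂ} (hβ : β ≠ 0) :
    ∃ j < L, ∑ s ∈ Finset.range (M + 1), ∑ l ∈ Finset.range L,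
      (padeCoeff M L j s l : ℂ) * β ^ s * α ^ l ≠ 0 := by
  by_contra! hall
  obtain ⟨c, hc, hdet⟩ := det_padeMatrix (M := M) hL
  let B : Matrix (Fin L) (Fin L) ℂ := (padeMatrix M L).map (aeval β : ℚ[X] →ₐ[ℚ] ℂ)
  have hBdet : B.det ≠ 0 := by
    have h1 : B.det = aeval β (padeMatrix M L).det :=
      (AlgHom.map_det (aeval β : ℚ[X] →ₐ[ℚ] ℂ) (padeMatrix M L)).symm
    rw [h1, hdet]
    simp [hc, hβ]
  -- If all forms vanished, `(α^l)` would lie in the kernel; it is nonzero, its entry at `l = 0`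
  -- being `1`.
  refine hBdet (Matrix.exists_mulVec_eq_zero_iff.1 ⟨fun l => α ^ (l : ℕ), ?_, ?_⟩)
  · intro h
    simpa using congrFun h ⟨0, hL⟩
  · ext j
    have h := hall j j.2
    rw [Finset.sum_comm, Finset.sum_range] at h
    rw [Pi.zero_apply, ← h, Matrix.mulVec, dotProduct]
    refine Finset.sum_congr rfl fun l _ => ?_
    have : B j l = ∑ s ∈ Finset.range (M + 1), (padeCoeff M L j s l : ℂ) * β ^ s := by
      simp [B, padeMatrix, padePolynomial, aeval_monomial]
    rw [this, Finset.sum_mul]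


/-! ### Denominators of the coefficients -/

lemma prod_range_erase {M : Type*} [CommMonoid M] (f : ℕ → M) (l r : ℕ) :
    ∏ m ∈ (Finset.range (l + 1 + r)).erase l, f m =
      (∏ m ∈ Finset.range l, f m) * ∏ k ∈ Finset.range r, f (l + 1 + k) := by
  have h1 : ∏ m ∈ (Finset.range (l + 1 + r)).erase l, f m =
      ∏ m ∈ (Finset.range (l + 1 + r)).erase l, Function.update f l 1 m :=
    Finset.prod_congr rfl fun m hm => by
      rw [Function.update_of_ne (Finset.ne_of_mem_erase hm)]
  rw [h1, Finset.prod_erase _ (by simp), Finset.prod_range_add, Finset.prod_range_succ,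
    Function.update_self, mul_one]
  congr 1
  · exact Finset.prod_congr rfl fun m hm => by
      rw [Function.update_of_ne (Finset.mem_range.1 hm).ne]
  · exact Finset.prod_congr rfl fun m _ => by
      rw [Function.update_of_ne (by omega)]

lemma prod_erase_pow_padeExponent {G : Type*} [CommMonoid G] (f : ℕ → G) {L j : ℕ} (hj : j < L)
    (M l : ℕ) : ∏ m ∈ (Finset.range L).erase l, f m ^ padeExponent M j m =
      (∏ m ∈ (Finset.range L).erase l, f m) ^ M * if l = j then 1 else f j := by
  have h1 : ∀ m ∈ (Finset.range L).erase l, f m ^ padeExponent M j m =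
      f m ^ M * if j = m then f m else 1 := by
    intro m _
    by_cases h : j = m
    · subst h
      rw [padeExponent_self, if_pos rfl, pow_succ]
    · rw [padeExponent_of_ne M (Ne.symm h), if_neg h, mul_one]
  rw [Finset.prod_congr rfl h1, Finset.prod_mul_distrib, Finset.prod_pow, Finset.prod_ite_eq]
  congr 1
  by_cases h : l = j
  · simp [h]
  · simp [h, hj, Ne.symm h]

/-- By Pascal's rule, the coefficient is a sum of two distinct entries of the previous row, whose
total is `2^(n-1)`. -/
lemma choose_le_two_pow_pred {n : ℕ} (hn : 0 < n) (k : ℕ) : n.choose k ≤ 2 ^ (n - 1) := by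
  obtain ⟨m, rfl⟩ := Nat.exists_eq_succ_of_ne_zero hn.ne'
  cases k with
  | zero => simpa using Nat.one_le_two_pow
  | succ k =>
    rw [Nat.succ_eq_add_one, Nat.choose_succ_succ, Nat.add_sub_cancel, ← Nat.sum_range_choose]
    by_cases hk : k + 1 ≤ m
    · calc m.choose k + m.choose (k + 1) = ∑ i ∈ {k, k + 1}, m.choose i := by
            rw [Finset.sum_pair (by omega)]
        _ ≤ _ := Finset.sum_le_sum_of_subset fun i hi => by
            simp only [Finset.mem_insert, Finset.mem_singleton] at hi
            rw [Finset.mem_range]; omega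
    · rw [Nat.choose_eq_zero_of_lt (n := m) (k := k + 1) (by omega), add_zero, Nat.sum_range_choose]
      exact Nat.choose_le_two_pow m k

/-- The barycentric weights of the nodes `0, …, L - 1`, scaled by `(L - 1)!`, are binomial
coefficients up to sign. -/
lemma exists_int_eq_factorial_mul_prod_inv {L l : ℕ} (hL : 2 ≤ L) (hl : l < L) :
    ∃ z : ℤ, (z : ℚ) = (L - 1).factorial *
      ∏ m ∈ (Finset.range L).erase l, ((l : ℚ) - m)⁻¹ ∧ |z| ≤ 2 ^ (L - 2) := by
  obtain ⟨r, rfl⟩ : ∃ r, L = l + 1 + r := ⟨L - (l + 1), by omega⟩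
  refine ⟨(-1) ^ r * (l + r).choose r, ?_, ?_⟩
  · have h1 : ∏ m ∈ Finset.range l, ((l : ℚ) - m) = l.factorial := by
      rw [← Finset.prod_range_add_one_eq_factorial, ← Finset.prod_range_reflect, Nat.cast_prod]
      refine Finset.prod_congr rfl fun m hm => ?_
      have : m < l := Finset.mem_range.1 hm
      rw [Nat.cast_add, Nat.cast_sub (by omega), Nat.cast_sub (by omega)]
      push_cast; ring
    have h2 : ∏ k ∈ Finset.range r, ((l : ℚ) - ((l + 1 + k : ℕ) : ℚ)) =
        (-1) ^ r * r.factorial := by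
      rw [← Finset.prod_range_add_one_eq_factorial, Nat.cast_prod]
      rw [show ((-1 : ℚ) ^ r) = ∏ _k ∈ Finset.range r, (-1 : ℚ) by simp,
        ← Finset.prod_mul_distrib]
      refine Finset.prod_congr rfl fun m _ => ?_
      push_cast; ring
    rw [Finset.prod_inv_distrib, prod_range_erase, h1, h2, show l + 1 + r - 1 = l + r by omega,
      ← Nat.add_choose_mul_factorial_mul_factorial]
    have hl0 : (l.factorial : ℚ) ≠ 0 := by exact_mod_cast l.factorial_ne_zero
    have hr0 : (r.factorial : ℚ) ≠ 0 := by exact_mod_cast r.factorial_ne_zero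
    have hs : ((-1 : ℚ) ^ r) * (-1) ^ r = 1 := by rw [← mul_pow]; simp
    have hs0 : ((-1 : ℚ) ^ r) ≠ 0 := by positivity
    push_cast
    field_simp
    linear_combination ((l + r).choose r : ℚ) * hs
  · rw [abs_mul, abs_pow, abs_neg, abs_one, one_pow, one_mul, Nat.abs_cast]
    have h := choose_le_two_pow_pred (n := l + r) (by omega) r
    rw [show l + 1 + r - 2 = l + r - 1 by omega]
    exact_mod_cast h

lemma dvd_lcmUpTo {n a : ℕ} (h1 : 1 ≤ a) (h2 : a ≤ n) : a ∣ lcmUpTo n :=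
  Finset.dvd_lcm (f := id) (Finset.mem_Icc.2 ⟨h1, h2⟩)

lemma lcmUpTo_pos (n : ℕ) : 0 < lcmUpTo n := by
  rw [Nat.pos_iff_ne_zero, lcmUpTo, Ne, Finset.lcm_eq_zero_iff]
  simp

lemma intCast_dvd_lcmUpTo {n : ℕ} {a : ℤ} (h1 : a ≠ 0) (h2 : |a| ≤ n) : a ∣ (lcmUpTo n : ℤ) := by
  rw [Int.abs_eq_natAbs] at h2
  rw [← abs_dvd, Int.abs_eq_natAbs, Int.natCast_dvd_natCast]
  exact dvd_lcmUpTo (by omega) (by omega)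

/-- `N` collects the primes above `n` in `m!`. For `q ≤ n`, Legendre's formula gives `v_q(s!) ≤ s`,
and the product of these primes divides the least common multiple; for `q > n`, `v_q(s!) ≤ v_q(m!)`.
-/
lemma exists_nat_factorialPart (m n : ℕ) : ∃ N : ℕ, 0 < N ∧ factorialPart m n = N ∧
    ∀ s ≤ m, s.factorial ∣ lcmUpTo n ^ s * N := by
  set B := m.factorial + n + 1 with hB
  set P := (Finset.range B).filter Nat.Prime with hP
  have hprod : ∀ s ≤ m, ∏ q ∈ P, q ^ padicValNat q s.factorial = s.factorial := fun s hs =>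
    Nat.prod_pow_prime_padicValNat _ s.factorial_ne_zero _ (by
      have := Nat.factorial_le hs
      omega)
  have hsmall : P.filter (· ≤ n) = (Finset.Icc 1 n).filter Nat.Prime := by
    ext q
    simp only [hP, Finset.mem_filter, Finset.mem_range, Finset.mem_Icc]
    constructor
    · rintro ⟨⟨_, hq⟩, hqn⟩
      exact ⟨⟨hq.one_le, hqn⟩, hq⟩
    · rintro ⟨⟨_, hqn⟩, hq⟩
      exact ⟨⟨by omega, hq⟩, hqn⟩
  have hprime : ∀ q ∈ P, q.Prime := fun q hq => (Finset.mem_filter.1 hq).2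
  set N := ∏ q ∈ P.filter (fun q => ¬ q ≤ n), q ^ padicValNat q m.factorial with hN
  have hsplit := fun s hs => (Finset.prod_filter_mul_prod_filter_not P (· ≤ n)
    fun q => q ^ padicValNat q s.factorial).trans (hprod s hs)
  refine ⟨N, ?_, ?_, ?_⟩
  · exact Finset.prod_pos fun q hq => pow_pos (hprime q (Finset.mem_filter.1 hq).1).pos _
  · rw [factorialPart, div_eq_iff, mul_comm]
    · have h := congrArg (Nat.cast (R := ℝ)) (hsplit m le_rfl)
      rw [hsmall, Nat.cast_mul, Nat.cast_prod] at h
      push_cast at h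
      rw [← h, hN]
      push_cast
      rfl
    · refine Finset.prod_ne_zero_iff.2 fun q hq => pow_ne_zero _ ?_
      exact_mod_cast (Finset.mem_filter.1 hq).2.ne_zero
  · intro s hs
    rw [← hsplit s hs]
    refine mul_dvd_mul ?_ ?_
    · calc _ ∣ ∏ q ∈ P.filter (· ≤ n), q ^ s := by
            refine Finset.prod_dvd_prod_of_dvd _ _ fun q hq => pow_dvd_pow _ ?_
            have hqp := hprime q (Finset.mem_filter.1 hq).1
            have := Fact.mk hqp
            have hleg := sub_one_mul_padicValNat_factorial (p := q) s
            have h2 := hqp.two_le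
            calc padicValNat q s.factorial ≤ (q - 1) * padicValNat q s.factorial :=
                  Nat.le_mul_of_pos_left _ (by omega)
              _ ≤ s := by rw [hleg]; omega
        _ = (∏ q ∈ P.filter (· ≤ n), q) ^ s := Finset.prod_pow _ _ _
        _ ∣ _ := by
            refine pow_dvd_pow_of_dvd (Finset.prod_primes_dvd _ ?_ ?_) s
            · intro q hq
              exact (hprime q (Finset.mem_filter.1 hq).1).prime
            · intro q hq
              rw [Finset.mem_filter] at hq
              exact dvd_lcmUpTo (hprime q hq.1).one_le hq.2
    · refine Finset.prod_dvd_prod_of_dvd _ _ fun q hq => pow_dvd_pow _ ?_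
      have := Fact.mk (hprime q (Finset.mem_filter.1 hq).1)
      exact (padicValNat_dvd_iff_le m.factorial_ne_zero).1
        (pow_padicValNat_dvd.trans (Nat.factorial_dvd_factorial hs))

/-- The product of the series `(1 + X / (l - m)) ^ (-n m)` over `m < L`, `m ≠ l`. -/
def unitFactor (L : ℕ) (n : ℕ → ℕ) (l : ℕ) : PowerSeries ℚ :=
  ∏ m ∈ (Finset.range L).erase l, geomSeries ((l : ℚ) - m) ^ n m

lemma localFactor_eq (L : ℕ) (n : ℕ → ℕ) (l : ℕ) :
    localFactor L n l = PowerSeries.C (∏ m ∈ (Finset.range L).erase l, (((l : ℚ) - m)⁻¹) ^ n m) *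
      unitFactor L n l := by
  rw [localFactor, unitFactor, map_prod, ← Finset.prod_mul_distrib]
  refine Finset.prod_congr rfl fun m _ => ?_
  rw [invLinear, mul_pow, map_pow]

/-- Replacing `X` by `dX` turns each geometric ratio into `-d / (l - m)`, an integer because `|l -
m| ≤ L - 1`. -/
lemma exists_int_coeff_unitFactor {L l : ℕ} (hl : l < L) (n : ℕ → ℕ) (i : ℕ) :
    ∃ z : ℤ, (z : ℚ) = (lcmUpTo (L - 1) : ℚ) ^ i * PowerSeries.coeff i (unitFactor L n l) := by
  set d := lcmUpTo (L - 1)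
  have hmem : PowerSeries.rescale (d : ℚ) (unitFactor L n l) ∈
      (PowerSeries.map (Int.castRingHom ℚ)).range := by
    rw [unitFactor, map_prod]
    refine Subring.prod_mem _ fun m hm => ?_
    rw [map_pow]
    refine Subring.pow_mem _ ?_ _
    rw [Finset.mem_erase, Finset.mem_range] at hm
    have h0 : (l : ℤ) - m ≠ 0 := by omega
    obtain ⟨z, hz⟩ := intCast_dvd_lcmUpTo (n := L - 1) h0 (by rw [abs_le]; omega)
    have h0' : (l : ℚ) - m ≠ 0 := by exact_mod_cast h0
    have hz' : (d : ℚ) = (l - m) * z := by exact_mod_cast congrArg (Int.cast (R := ℚ)) hz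
    refine ⟨PowerSeries.mk fun i => (-z) ^ i, ?_⟩
    ext i
    rw [PowerSeries.coeff_map, PowerSeries.coeff_mk, PowerSeries.coeff_rescale, geomSeries,
      PowerSeries.coeff_mk, ← mul_pow, hz']
    have : (l - m) * (z : ℚ) * -((l : ℚ) - m)⁻¹ = -z := by field_simp
    rw [this]
    simp
  obtain ⟨g, hg⟩ := hmem
  refine ⟨PowerSeries.coeff i g, ?_⟩
  have := congrArg (PowerSeries.coeff i) hg
  rw [PowerSeries.coeff_map, PowerSeries.coeff_rescale] at this
  exact this

lemma factorial_pow_mul_padeCoeff {L j : ℕ} (hj : j < L) (M s l : ℕ) :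
    (((L - 1).factorial : ℚ)) ^ M * padeCoeff M L j s l =
      ((L - 1).factorial * ∏ m ∈ (Finset.range L).erase l, ((l : ℚ) - m)⁻¹) ^ M *
      (if l = j then 1 else ((l : ℚ) - j)⁻¹) *
      PowerSeries.coeff (padeExponent M j l)
        (PowerSeries.X ^ (s + 1) * unitFactor L (padeExponent M j) l) / s.factorial := by
  rw [padeCoeff, partialFractionCoeff, localFactor_eq,
    prod_erase_pow_padeExponent (fun m : ℕ => ((l : ℚ) - m)⁻¹) hj, mul_left_comm,
    PowerSeries.coeff_C_mul]
  ring

lemma exists_int_eq_mul_padeCoeff {L j l M s N : ℕ} (hL : 2 ≤ L) (hj : j < L) (hl : l < L)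
    (hN : s.factorial ∣ lcmUpTo (L - 1) ^ s * N) :
    ∃ z : ℤ, (z : ℚ) = (lcmUpTo (L - 1) : ℚ) ^ M * N *
      (((L - 1).factorial : ℚ) ^ M * padeCoeff M L j s l) := by
  rw [factorial_pow_mul_padeCoeff hj]
  obtain ⟨w, hw, -⟩ := exists_int_eq_factorial_mul_prod_inv hL hl
  rw [← hw]
  obtain ⟨t, ht⟩ := hN
  have ht' : (lcmUpTo (L - 1) : ℚ) ^ s * N = s.factorial * t := by exact_mod_cast ht
  have hs0 : (s.factorial : ℚ) ≠ 0 := by exact_mod_cast s.factorial_ne_zero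
  rw [PowerSeries.coeff_X_pow_mul']
  by_cases hsn : s + 1 ≤ padeExponent M j l
  swap
  · rw [if_neg hsn]
    exact ⟨0, by simp⟩
  rw [if_pos hsn]
  obtain ⟨z, hz⟩ := exists_int_coeff_unitFactor hl (padeExponent M j)
    (padeExponent M j l - (s + 1))
  set c := PowerSeries.coeff (padeExponent M j l - (s + 1)) (unitFactor L (padeExponent M j) l)
  by_cases hlj : l = j
  · rw [if_pos hlj]
    rw [hlj, padeExponent_self] at hsn hz
    refine ⟨w ^ M * z * t, ?_⟩
    -- The power `d^(M-s)` clears the series coefficient and `d^s N` clears `s!`.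
    have hpow : (lcmUpTo (L - 1) : ℚ) ^ M =
        (lcmUpTo (L - 1) : ℚ) ^ (M + 1 - (s + 1)) * (lcmUpTo (L - 1) : ℚ) ^ s := by
      rw [← pow_add]; congr 1; omega
    push_cast
    rw [hz, hpow]
    field_simp
    linear_combination (-(w : ℚ) ^ M * (lcmUpTo (L - 1) : ℚ) ^ (M + 1 - (s + 1)) * c) * ht'
  · rw [if_neg hlj]
    rw [padeExponent_of_ne M hlj] at hsn hz
    have h0 : (l : ℤ) - j ≠ 0 := by omega
    obtain ⟨y, hy⟩ := intCast_dvd_lcmUpTo (n := L - 1) h0 (by rw [abs_le]; omega)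
    have h0' : (l : ℚ) - j ≠ 0 := by exact_mod_cast h0
    have hy' : (lcmUpTo (L - 1) : ℚ) = (l - j) * y := by
      exact_mod_cast congrArg (Int.cast (R := ℚ)) hy
    refine ⟨w ^ M * z * y * t, ?_⟩
    -- Here the pole has order `M` only, so the series coefficient needs one `d` fewer; the spare
    -- one clears `(l - j)⁻¹`.
    have hpow : (lcmUpTo (L - 1) : ℚ) ^ M =
        (lcmUpTo (L - 1) : ℚ) ^ (M - (s + 1)) * (l - j) * y * (lcmUpTo (L - 1) : ℚ) ^ s := by
      rw [mul_assoc _ ((l : ℚ) - j), ← hy', ← pow_succ, ← pow_add]; congr 1; omega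
    push_cast
    rw [hz, hpow]
    field_simp
    linear_combination (-(w : ℚ) ^ M * (lcmUpTo (L - 1) : ℚ) ^ (M - (s + 1)) * c * y) * ht'


/-! ### Size of the coefficients -/

/-- `B` bounds the weighted `ℓ¹`-norm of the coefficients of `f` at radius `1 / 4`. -/
def WeightedBound (f : PowerSeries ℚ) (B : ℝ) : Prop :=
  ∀ N : ℕ, ∑ i ∈ Finset.range N, |((PowerSeries.coeff i f : ℚ) : ℝ)| * (1 / 4) ^ i ≤ B

lemma WeightedBound.nonneg {f : PowerSeries ℚ} {B : ℝ} (h : WeightedBound f B) : 0 ≤ B := by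
  simpa using h 0

lemma weightedBound_one : WeightedBound 1 1 := by
  intro N
  cases N with
  | zero => simp
  | succ N =>
    rw [Finset.sum_range_succ', Finset.sum_eq_zero]
    · simp
    · intro i _
      simp [PowerSeries.coeff_one]

lemma WeightedBound.mul {f g : PowerSeries ℚ} {A B : ℝ} (hf : WeightedBound f A)
    (hg : WeightedBound g B) : WeightedBound (f * g) (A * B) := by
  intro N
  set a : ℕ → ℝ := fun i => |((PowerSeries.coeff i f : ℚ) : ℝ)| * (1 / 4) ^ i with ha
  set b : ℕ → ℝ := fun i => |((PowerSeries.coeff i g : ℚ) : ℝ)| * (1 / 4) ^ i with hb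
  have ha0 : ∀ i, 0 ≤ a i := fun i => by positivity
  have hb0 : ∀ i, 0 ≤ b i := fun i => by positivity
  calc ∑ i ∈ Finset.range N, |((PowerSeries.coeff i (f * g) : ℚ) : ℝ)| * (1 / 4) ^ i
      ≤ ∑ i ∈ Finset.range N, ∑ k ∈ Finset.range (i + 1), a k * b (i - k) := by
        refine Finset.sum_le_sum fun i _ => ?_
        rw [PowerSeries.coeff_mul, Finset.Nat.sum_antidiagonal_eq_sum_range_succ
          (fun k l => PowerSeries.coeff k f * PowerSeries.coeff l g), Rat.cast_sum]
        refine (mul_le_mul_of_nonneg_right (Finset.abs_sum_le_sum_abs _ _)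
          (by positivity)).trans_eq ?_
        rw [Finset.sum_mul]
        refine Finset.sum_congr rfl fun k hk => ?_
        have hki : k + (i - k) = i := by
          have := Finset.mem_range.1 hk
          omega
        have hpow : ((1 : ℝ) / 4) ^ i = (1 / 4) ^ k * (1 / 4) ^ (i - k) := by
          rw [← pow_add, hki]
        rw [Rat.cast_mul, abs_mul, hpow, ha, hb]
        ring
    _ = ∑ k ∈ Finset.range N, ∑ m ∈ Finset.range (N - k), a k * b m :=
        Finset.sum_range_diag_flip N fun k m => a k * b m
    _ ≤ ∑ k ∈ Finset.range N, a k * B := by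
        refine Finset.sum_le_sum fun k _ => ?_
        rw [← Finset.mul_sum]
        exact mul_le_mul_of_nonneg_left (hg _) (ha0 k)
    _ ≤ A * B := by
        rw [← Finset.sum_mul]
        exact mul_le_mul_of_nonneg_right (hf N) hg.nonneg

lemma WeightedBound.pow {f : PowerSeries ℚ} {A : ℝ} (hf : WeightedBound f A) (n : ℕ) :
    WeightedBound (f ^ n) (A ^ n) := by
  induction n with
  | zero => simpa using weightedBound_one
  | succ n ih =>
    rw [pow_succ, pow_succ]
    exact ih.mul hf

lemma weightedBound_prod {ι : Type*} (s : Finset ι) (f : ι → PowerSeries ℚ) (A : ι → ℝ)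
    (h : ∀ i ∈ s, WeightedBound (f i) (A i)) : WeightedBound (∏ i ∈ s, f i) (∏ i ∈ s, A i) := by
  classical
  induction s using Finset.induction_on with
  | empty => simpa using weightedBound_one
  | insert i s hi ih =>
    rw [Finset.prod_insert hi, Finset.prod_insert hi]
    exact (h i (by simp)).mul (ih fun k hk => h k (by simp [hk]))

lemma weightedBound_geomSeries {a : ℚ} (ha : 1 ≤ |a|) :
    WeightedBound (geomSeries a) (1 - 1 / (4 * |(a : ℝ)|))⁻¹ := by
  intro N
  have ha' : (1 : ℝ) ≤ |(a : ℝ)| := by exact_mod_cast ha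
  have h0 : (0 : ℝ) ≤ 1 / (4 * |(a : ℝ)|) := by positivity
  have h1 : 1 / (4 * |(a : ℝ)|) < 1 := by
    rw [div_lt_one (by positivity)]
    linarith
  have hterm : ∀ i, |((PowerSeries.coeff i (geomSeries a) : ℚ) : ℝ)| * (1 / 4) ^ i =
      (1 / (4 * |(a : ℝ)|)) ^ i := by
    intro i
    rw [geomSeries, PowerSeries.coeff_mk]
    push_cast
    rw [abs_pow, abs_neg, abs_inv, ← mul_pow]
    congr 1
    ring
  rw [Finset.sum_congr rfl fun i _ => hterm i, ← tsum_geometric_of_lt_one h0 h1]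
  exact (summable_geometric_of_lt_one h0 h1).sum_le_tsum _ fun i _ => by positivity

/-- The bound for the series `(1 + X / a)⁻¹`, as a function of `|a|`. -/
def geomBound (k : ℝ) : ℝ := (1 - 1 / (4 * k))⁻¹

lemma geomBound_le_two {k : ℝ} (hk : 1 ≤ k) : geomBound k ≤ 2 := by
  rw [geomBound, inv_le_comm₀ _ (by norm_num)]
  · have : 1 / (4 * k) ≤ 1 / 4 := by
      apply one_div_le_one_div_of_le <;> linarith
    linarith
  · have : 1 / (4 * k) ≤ 1 / 4 := by
      apply one_div_le_one_div_of_le <;> linarith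
    linarith

lemma geomBound_pos {k : ℝ} (hk : 1 ≤ k) : 0 < geomBound k := by
  have : 1 / (4 * k) ≤ 1 / 4 := by
    apply one_div_le_one_div_of_le <;> linarith
  rw [geomBound, inv_pos]
  linarith

/-- The factors are `4k / (4k - 1)`, so the product grows like `a^(1/4)`; the fourth power makes the
bound linear and provable by induction. -/
lemma prod_geomBound_pow_four_le (a : ℕ) :
    (∏ k ∈ Finset.range a, geomBound ((k : ℝ) + 1)) ^ 4 ≤ 1 + 3 * a := by
  induction a with
  | zero => simp
  | succ a ih =>
    rw [Finset.prod_range_succ, mul_pow]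
    have ha : (0 : ℝ) ≤ a := by positivity
    have h1 : geomBound ((a : ℝ) + 1) = (4 * (a + 1)) / (4 * a + 3) := by
      rw [geomBound, inv_eq_iff_eq_inv, inv_div]
      field_simp
      ring
    calc _ ≤ (1 + 3 * (a : ℝ)) * geomBound ((a : ℝ) + 1) ^ 4 := by gcongr
      _ ≤ _ := by
        rw [h1, div_pow, ← mul_div_assoc, div_le_iff₀ (by positivity)]
        push_cast
        have : 0 ≤ 32 * (a : ℝ) ^ 3 + 144 * a ^ 2 + 179 * a + 68 := by positivity
        nlinarith [this]

lemma prod_erase_geomBound_le {L l : ℕ} (hl : l < L) :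
    ∏ m ∈ (Finset.range L).erase l, geomBound |(l : ℝ) - m| ≤ √(3 * L) := by
  obtain ⟨r, rfl⟩ : ∃ r, L = l + 1 + r := ⟨L - (l + 1), by omega⟩
  rw [prod_range_erase]
  have h1 : ∏ m ∈ Finset.range l, geomBound |(l : ℝ) - m| =
      ∏ k ∈ Finset.range l, geomBound ((k : ℝ) + 1) := by
    rw [← Finset.prod_range_reflect]
    refine Finset.prod_congr rfl fun m hm => ?_
    have : m < l := Finset.mem_range.1 hm
    rw [Nat.cast_sub (by omega), Nat.cast_sub (by omega), abs_of_nonneg] <;> push_cast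
    · congr 1; ring
    · linarith [show (0 : ℝ) ≤ m by positivity]
  have h2 : ∏ k ∈ Finset.range r, geomBound |(l : ℝ) - ((l + 1 + k : ℕ) : ℝ)| =
      ∏ k ∈ Finset.range r, geomBound ((k : ℝ) + 1) := by
    refine Finset.prod_congr rfl fun m _ => ?_
    congr 1
    rw [abs_of_nonpos] <;> push_cast <;> linarith [show (0 : ℝ) ≤ m by positivity]
  rw [h1, h2]
  apply Real.le_sqrt_of_sq_le
  have hnn : ∀ a : ℕ, 0 ≤ ∏ k ∈ Finset.range a, geomBound ((k : ℝ) + 1) := fun a =>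
    Finset.prod_nonneg fun k _ => (geomBound_pos (by linarith [show (0 : ℝ) ≤ k by positivity])).le
  refine abs_le_of_sq_le_sq' ?_ (by positivity) |>.2
  have hl0 : (0 : ℝ) ≤ l := by positivity
  have hr0 : (0 : ℝ) ≤ r := by positivity
  calc _ = (∏ k ∈ Finset.range l, geomBound ((k : ℝ) + 1)) ^ 4 *
        (∏ k ∈ Finset.range r, geomBound ((k : ℝ) + 1)) ^ 4 := by ring
    _ ≤ (1 + 3 * l) * (1 + 3 * r) := mul_le_mul (prod_geomBound_pow_four_le l)
        (prod_geomBound_pow_four_le r) (pow_nonneg (hnn r) _) (by positivity)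
    _ ≤ _ := by
        push_cast
        nlinarith [mul_nonneg hl0 hr0]

lemma one_le_abs_natCast_sub {l m : ℕ} (h : l ≠ m) : 1 ≤ |(l : ℚ) - m| := by
  have h1 : (l : ℤ) - m ≠ 0 := by omega
  exact_mod_cast Int.one_le_abs h1

/-- The factor `2` pays for the one extra exponent at `j`. -/
lemma weightedBound_unitFactor {L j l : ℕ} (hj : j < L) (hl : l < L) (M : ℕ) :
    WeightedBound (unitFactor L (padeExponent M j) l) (2 * √(3 * L) ^ M) := by
  have hge : ∀ m, l ≠ m → (1 : ℝ) ≤ |(l : ℝ) - m| := fun m hm => by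
    exact_mod_cast one_le_abs_natCast_sub hm
  have hb : WeightedBound (unitFactor L (padeExponent M j) l)
      (∏ m ∈ (Finset.range L).erase l, geomBound |(l : ℝ) - m| ^ padeExponent M j m) := by
    refine weightedBound_prod _ _ _ fun m hm => WeightedBound.pow ?_ _
    have h := weightedBound_geomSeries
      (one_le_abs_natCast_sub (Finset.ne_of_mem_erase hm).symm)
    push_cast at h
    exact h
  intro N
  refine (hb N).trans ?_
  rw [prod_erase_pow_padeExponent (fun m : ℕ => geomBound |(l : ℝ) - m|) hj, mul_comm]
  have hpos : 0 ≤ ∏ m ∈ (Finset.range L).erase l, geomBound |(l : ℝ) - m| :=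
    Finset.prod_nonneg fun m hm => (geomBound_pos (hge m (Finset.ne_of_mem_erase hm).symm)).le
  refine mul_le_mul ?_ (pow_le_pow_left₀ hpos (prod_erase_geomBound_le hl) M)
    (pow_nonneg hpos _) (by norm_num)
  split_ifs with h
  · norm_num
  · exact geomBound_le_two (hge j h)

/-- The sum runs over coefficients of `f` of index at most `M`, where undoing the weight `(1/4)^i`
costs at most `4^M`. -/
lemma WeightedBound.sum_abs_coeff_le {f : PowerSeries ℚ} {B : ℝ} (hf : WeightedBound f B)
    {M n : ℕ} (hn : n ≤ M + 1) :
    ∑ s ∈ Finset.range (M + 1), |((PowerSeries.coeff n (PowerSeries.X ^ (s + 1) * f) : ℚ) : ℝ)| ≤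
      4 ^ M * B := by
  have hsub : ∑ s ∈ Finset.range (M + 1),
      |((PowerSeries.coeff n (PowerSeries.X ^ (s + 1) * f) : ℚ) : ℝ)| =
      ∑ s ∈ Finset.range n, |((PowerSeries.coeff (n - 1 - s) f : ℚ) : ℝ)| := by
    rw [← Finset.sum_subset (Finset.range_mono hn)]
    · refine Finset.sum_congr rfl fun s hs => ?_
      have := Finset.mem_range.1 hs
      rw [PowerSeries.coeff_X_pow_mul', if_pos (by omega), show n - (s + 1) = n - 1 - s by omega]
    · intro s _ hs
      rw [Finset.mem_range, not_lt] at hs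
      rw [PowerSeries.coeff_X_pow_mul', if_neg (by omega)]
      simp
  rw [hsub, Finset.sum_range_reflect (fun i => |((PowerSeries.coeff i f : ℚ) : ℝ)|)]
  refine le_trans ?_ (mul_le_mul_of_nonneg_left (hf n) (by positivity))
  rw [Finset.mul_sum]
  refine Finset.sum_le_sum fun i hi => ?_
  have hi' : i ≤ M := by
    have := Finset.mem_range.1 hi
    omega
  have h4 : (1 : ℝ) ≤ 4 ^ M * (1 / 4) ^ i := by
    rw [one_div, inv_pow, ← div_eq_mul_inv, one_le_div (by positivity)]
    exact pow_le_pow_right₀ (by norm_num) hi'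
  nlinarith [abs_nonneg ((PowerSeries.coeff i f : ℚ) : ℝ)]

lemma sum_abs_padeCoeff_le {L j l : ℕ} (hL : 2 ≤ L) (hj : j < L) (hl : l < L) (M : ℕ) :
    ∑ s ∈ Finset.range (M + 1), |(((L - 1).factorial : ℝ)) ^ M * padeCoeff M L j s l| ≤
      2 * (2 ^ L * √(3 * L)) ^ M := by
  obtain ⟨w, hw, hwle⟩ := exists_int_eq_factorial_mul_prod_inv hL hl
  have hwR : |(w : ℝ)| ≤ 2 ^ (L - 2) := by exact_mod_cast hwle
  have hterm : ∀ s, |(((L - 1).factorial : ℝ)) ^ M * padeCoeff M L j s l| ≤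
      (2 ^ (L - 2)) ^ M * |((PowerSeries.coeff (padeExponent M j l)
        (PowerSeries.X ^ (s + 1) * unitFactor L (padeExponent M j) l) : ℚ) : ℝ)| := by
    intro s
    have h := congrArg (Rat.cast (K := ℝ)) (factorial_pow_mul_padeCoeff hj M s l)
    rw [← hw] at h
    set c := PowerSeries.coeff (padeExponent M j l)
        (PowerSeries.X ^ (s + 1) * unitFactor L (padeExponent M j) l)
    rw [Rat.cast_mul, Rat.cast_pow, Rat.cast_natCast] at h
    rw [h, Rat.cast_div, Rat.cast_mul, Rat.cast_mul, Rat.cast_pow, Rat.cast_intCast,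
      Rat.cast_natCast, abs_div, abs_mul, abs_mul, abs_pow, Nat.abs_cast]
    have hfac : (1 : ℝ) ≤ s.factorial := by exact_mod_cast s.factorial_pos
    have hinv : |((if l = j then 1 else ((l : ℚ) - j)⁻¹ : ℚ) : ℝ)| ≤ 1 := by
      split_ifs with h
      · simp
      · have := one_le_abs_natCast_sub h
        rw [← Rat.cast_abs, abs_inv]
        exact_mod_cast inv_le_one_of_one_le₀ this
    calc _ ≤ |(w : ℝ)| ^ M * |((if l = j then 1 else ((l : ℚ) - j)⁻¹ : ℚ) : ℝ)| * |(c : ℝ)| :=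
          div_le_self (by positivity) hfac
      _ ≤ (2 ^ (L - 2)) ^ M * 1 * |(c : ℝ)| := by gcongr
      _ = _ := by rw [mul_one]
  refine (Finset.sum_le_sum fun s _ => hterm s).trans ?_
  rw [← Finset.mul_sum]
  refine (mul_le_mul_of_nonneg_left ((weightedBound_unitFactor hj hl M).sum_abs_coeff_le
    (padeExponent_le M j l)) (by positivity)).trans_eq ?_
  -- The binomial weights give `2^(L-2)` and the radius `1/4` gives `4`, together `2^L`, all to the
  -- power `M`.
  obtain ⟨r, rfl⟩ : ∃ r, L = r + 2 := ⟨L - 2, by omega⟩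
  rw [Nat.add_sub_cancel, pow_add, mul_pow, mul_pow]
  norm_num
  ring

/-! ### Integral Hermite–Padé forms -/

/-- Hermite–Padé forms with integer coefficients of controlled size, not vanishing at a given
point. -/
lemma exists_int_pade_form (M : ℕ) {L : ℕ} (hL : 2 ≤ L) (α : ℂ) {β : ℂ} (hβ : β ≠ 0) :
    ∃ p : ℕ → ℕ → ℤ,
      (∀ i < M * L, ∑ s ∈ Finset.range (M + 1), ∑ l ∈ Finset.range L, (p s l : ℂ) *
        (if s ≤ i then (l : ℂ) ^ (i - s) / (i - s).factorial else 0) = 0) ∧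
      ∑ s ∈ Finset.range (M + 1), ∑ l ∈ Finset.range L, |(p s l : ℝ)| ≤
        (lcmUpTo (L - 1) : ℝ) ^ M * factorialPart M (L - 1) * (L * (2 * (2 ^ L * √(3 * L)) ^ M)) ∧
      ∑ s ∈ Finset.range (M + 1), ∑ l ∈ Finset.range L, (p s l : ℂ) * β ^ s * α ^ l ≠ 0 := by
  obtain ⟨j, hj, hne⟩ := exists_pade_form_ne_zero (M := M) (L := L) (by omega) α hβ
  obtain ⟨N, hN0, hN, hdvd⟩ := exists_nat_factorialPart M (L - 1)
  set d := lcmUpTo (L - 1) with hd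
  set μ : ℚ := (d : ℚ) ^ M * N * ((L - 1).factorial : ℚ) ^ M with hμ
  have hd0 : d ≠ 0 := (lcmUpTo_pos _).ne'
  have hμ0 : μ ≠ 0 := by
    have := (L - 1).factorial_ne_zero
    positivity
  have hex : ∀ s l, ∃ z : ℤ, s < M + 1 → l < L → (z : ℚ) = μ * padeCoeff M L j s l := by
    intro s l
    by_cases h : s < M + 1 ∧ l < L
    · obtain ⟨z, hz⟩ := exists_int_eq_mul_padeCoeff (M := M) hL hj h.2 (hdvd s (by omega))
      exact ⟨z, fun _ _ => by rw [hz, hμ]; ring⟩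
    · exact ⟨0, fun h1 h2 => absurd ⟨h1, h2⟩ h⟩
  choose p hp using hex
  have hpC : ∀ s ∈ Finset.range (M + 1), ∀ l ∈ Finset.range L,
      (p s l : ℂ) = μ * padeCoeff M L j s l := fun s hs l hl => by
    have h := hp s l (Finset.mem_range.1 hs) (Finset.mem_range.1 hl)
    exact_mod_cast congrArg (Rat.cast (K := ℂ)) h
  refine ⟨p, ?_, ?_, ?_⟩
  · intro i hi
    have h := congrArg (Rat.cast (K := ℂ)) (sum_padeCoeff_eq_zero hj hi)
    rw [Finset.sum_comm] at h
    rw [Finset.sum_congr rfl fun s hs => Finset.sum_congr rfl fun l hl => by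
      rw [hpC s hs l hl, mul_assoc]]
    simp_rw [← Finset.mul_sum]
    refine mul_eq_zero_of_right _ ?_
    push_cast [apply_ite (Rat.cast (K := ℂ))] at h
    exact h
  · rw [Finset.sum_comm]
    have hpR : ∀ l ∈ Finset.range L, ∀ s ∈ Finset.range (M + 1), |(p s l : ℝ)| =
        (d : ℝ) ^ M * N * |((L - 1).factorial : ℝ) ^ M * padeCoeff M L j s l| := by
      intro l hl s hs
      have h := hp s l (Finset.mem_range.1 hs) (Finset.mem_range.1 hl)
      have hR : (p s l : ℝ) = (d : ℝ) ^ M * N * (((L - 1).factorial : ℝ) ^ M *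
          padeCoeff M L j s l) := by
        have h' := congrArg (Rat.cast (K := ℝ)) h
        rw [hμ] at h'
        push_cast at h'
        rw [h']; ring
      rw [hR, abs_mul, abs_of_nonneg (a := (d : ℝ) ^ M * N) (by positivity)]
    rw [Finset.sum_congr rfl fun l hl => Finset.sum_congr rfl fun s hs => hpR l hl s hs, hN]
    simp_rw [← Finset.mul_sum]
    refine mul_le_mul_of_nonneg_left ?_ (by positivity)
    refine (Finset.sum_le_sum fun l hl =>
      sum_abs_padeCoeff_le hL hj (Finset.mem_range.1 hl) M).trans_eq ?_
    rw [Finset.sum_const, Finset.card_range, nsmul_eq_mul]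
  · rw [Finset.sum_congr rfl fun s hs => Finset.sum_congr rfl fun l hl => by
      rw [hpC s hs l hl, mul_assoc, mul_assoc, ← mul_assoc (padeCoeff M L j s l : ℂ)]]
    simp_rw [← Finset.mul_sum]
    exact mul_ne_zero (by exact_mod_cast hμ0) hne

end

/-! ### Analytic upper bound -/

lemma hasSum_pow_mul_exp {𝕜 : Type*} [RCLike 𝕜] (s l : ℕ) (z : 𝕜) :
    HasSum (fun i => (if s ≤ i then (l : 𝕜) ^ (i - s) / (i - s).factorial else 0) * z ^ i)
      (z ^ s * NormedSpace.exp (l * z)) := by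
  have h := (NormedSpace.expSeries_div_hasSum_exp (𝔸 := 𝕜) ((l : 𝕜) * z)).mul_left (z ^ s)
  rw [← hasSum_nat_add_iff' s, Finset.sum_eq_zero, sub_zero]
  · refine h.congr_fun ?_
    intro i
    rw [if_pos (by omega), Nat.add_sub_cancel, mul_pow, pow_add]
    ring
  · intro i hi
    rw [if_neg (by simpa using hi), zero_mul]

/-- If the Taylor coefficients of an exponential polynomial vanish up to order `N`, its value at
`β` is at most `E ^ (-N)` times a majorant at `E * ‖β‖`. -/
lemma norm_sum_exp_le_of_vanishing (p : ℕ → ℕ → ℤ) (a b N : ℕ) (β : ℂ) {E : ℝ} (hE : 1 ≤ E)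
    (hp : ∀ i < N, ∑ s ∈ Finset.range a, ∑ l ∈ Finset.range b, (p s l : ℂ) *
      (if s ≤ i then (l : ℂ) ^ (i - s) / (i - s).factorial else 0) = 0) :
    ‖∑ s ∈ Finset.range a, ∑ l ∈ Finset.range b, (p s l : ℂ) * (β ^ s * Complex.exp (l * β))‖ ≤
      (E ^ N)⁻¹ * ∑ s ∈ Finset.range a, ∑ l ∈ Finset.range b,
        |(p s l : ℝ)| * ((E * ‖β‖) ^ s * Real.exp (l * (E * ‖β‖))) := by
  have hC : HasSum (fun i => ∑ s ∈ Finset.range a, ∑ l ∈ Finset.range b, (p s l : ℂ) *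
      ((if s ≤ i then (l : ℂ) ^ (i - s) / (i - s).factorial else 0) * β ^ i))
      (∑ s ∈ Finset.range a, ∑ l ∈ Finset.range b, (p s l : ℂ) * (β ^ s * Complex.exp (l * β))) :=
    hasSum_sum fun s _ => hasSum_sum fun l _ => by
      rw [Complex.exp_eq_exp_ℂ]
      exact (hasSum_pow_mul_exp s l β).mul_left _
  have hR : HasSum (fun i => (E ^ N)⁻¹ * ∑ s ∈ Finset.range a, ∑ l ∈ Finset.range b,
      |(p s l : ℝ)| * ((if s ≤ i then (l : ℝ) ^ (i - s) / (i - s).factorial else 0) *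
        (E * ‖β‖) ^ i))
      ((E ^ N)⁻¹ * ∑ s ∈ Finset.range a, ∑ l ∈ Finset.range b,
        |(p s l : ℝ)| * ((E * ‖β‖) ^ s * Real.exp (l * (E * ‖β‖)))) :=
    (hasSum_sum fun s _ => hasSum_sum fun l _ => by
      rw [Real.exp_eq_exp_ℝ]
      exact (hasSum_pow_mul_exp s l (E * ‖β‖)).mul_left _).mul_left _
  refine hC.norm_le_of_bounded hR fun i => ?_
  have hE0 : 0 < E := by linarith
  by_cases hi : i < N
  · have h0 : ∑ s ∈ Finset.range a, ∑ l ∈ Finset.range b, (p s l : ℂ) *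
        ((if s ≤ i then (l : ℂ) ^ (i - s) / (i - s).factorial else 0) * β ^ i) = 0 := by
      simp_rw [← mul_assoc, ← Finset.sum_mul]
      rw [hp i hi, zero_mul]
    rw [h0, norm_zero]
    positivity
  · rw [Finset.mul_sum]
    refine norm_sum_le_of_le _ fun s _ => ?_
    rw [Finset.mul_sum]
    refine norm_sum_le_of_le _ fun l _ => ?_
    have hc : ‖(if s ≤ i then (l : ℂ) ^ (i - s) / (i - s).factorial else 0)‖ =
        if s ≤ i then (l : ℝ) ^ (i - s) / (i - s).factorial else 0 := by
      split_ifs <;> simp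
    -- A termwise substitute for Schwarz's lemma: only indices `i ≥ N` survive, and for them `E^N ≤
    -- E^i`.
    have hpow : ‖β‖ ^ i ≤ (E ^ N)⁻¹ * (E * ‖β‖) ^ i := by
      rw [mul_pow, ← mul_assoc]
      refine le_mul_of_one_le_left (by positivity) ?_
      rw [inv_mul_eq_div, one_le_div (by positivity)]
      exact pow_le_pow_right₀ hE (not_lt.1 hi)
    rw [norm_mul, norm_mul, norm_pow, hc, Complex.norm_intCast]
    calc _ ≤ |(p s l : ℝ)| * ((if s ≤ i then (l : ℝ) ^ (i - s) / (i - s).factorial else 0) *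
          ((E ^ N)⁻¹ * (E * ‖β‖) ^ i)) := by
          refine mul_le_mul_of_nonneg_left (mul_le_mul_of_nonneg_left hpow ?_) (abs_nonneg _)
          positivity
      _ = _ := by ring

lemma norm_pow_sub_pow_le_mul {x y : ℂ} {R : ℝ} (hR : 1 ≤ R) (hx : ‖x‖ ≤ R) (hy : ‖y‖ ≤ R)
    (l : ℕ) : ‖x ^ l - y ^ l‖ ≤ l * R ^ l * ‖x - y‖ := by
  induction l with
  | zero => simp
  | succ l ih =>
    have h : x ^ (l + 1) - y ^ (l + 1) = x * (x ^ l - y ^ l) + (x - y) * y ^ l := by ring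
    have hy' : ‖y‖ ^ l ≤ R ^ (l + 1) :=
      (pow_le_pow_left₀ (norm_nonneg _) hy l).trans (pow_le_pow_right₀ hR (by omega))
    calc _ ≤ ‖x‖ * ‖x ^ l - y ^ l‖ + ‖x - y‖ * ‖y‖ ^ l := by
          rw [h]
          refine (norm_add_le _ _).trans_eq ?_
          rw [norm_mul, norm_mul, norm_pow]
      _ ≤ R * (l * R ^ l * ‖x - y‖) + ‖x - y‖ * R ^ (l + 1) := by gcongr
      _ = _ := by push_cast; ring

/-- The bound `x^s ≤ s! e^x` costs one extra exponential, which fits because `l + 1 ≤ L`. -/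
lemma pow_mul_exp_le {x : ℝ} (hx : 0 ≤ x) {s l M L : ℕ} (hs : s < M + 1) (hl : l < L) :
    x ^ s * Real.exp (l * x) ≤ M.factorial * Real.exp (L * x) := by
  have h1 : x ^ s ≤ s.factorial * Real.exp x := by
    have := Real.pow_div_factorial_le_exp x hx s
    rwa [div_le_iff₀ (by positivity), mul_comm] at this
  have h2 : (s.factorial : ℝ) ≤ M.factorial := by
    exact_mod_cast Nat.factorial_le (by omega)
  have h3 : ((l + 1 : ℕ) : ℝ) ≤ L := by exact_mod_cast hl
  calc x ^ s * Real.exp (l * x) ≤ (s.factorial * Real.exp x) * Real.exp (l * x) := by gcongr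
    _ = s.factorial * Real.exp ((l + 1 : ℕ) * x) := by
        rw [mul_assoc, ← Real.exp_add]
        congr 2
        push_cast; ring
    _ ≤ _ := by gcongr

/-- Upper bound for the value at `(β, α)` of a form vanishing to high order, when `α` is close to
`exp β`. -/
lemma norm_sum_le_of_vanishing_of_norm_exp_sub_le (p : ℕ → ℕ → ℤ) (M : ℕ) {L : ℕ} (hL : 1 ≤ L)
    (α β : ℂ) {E H : ℝ} (hE : 1 ≤ E)
    (hp : ∀ i < M * L, ∑ s ∈ Finset.range (M + 1), ∑ l ∈ Finset.range L, (p s l : ℂ) *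
      (if s ≤ i then (l : ℂ) ^ (i - s) / (i - s).factorial else 0) = 0)
    (hH : ∑ s ∈ Finset.range (M + 1), ∑ l ∈ Finset.range L, |(p s l : ℝ)| ≤ H)
    (hα : ‖Complex.exp β - α‖ ≤ (E ^ (M * L))⁻¹) :
    ‖∑ s ∈ Finset.range (M + 1), ∑ l ∈ Finset.range L, (p s l : ℂ) * β ^ s * α ^ l‖ ≤
      (E ^ (M * L))⁻¹ * H * M.factorial * Real.exp (L * (E * ‖β‖)) * (L * 2 ^ (L - 1)) := by
  set N := M * L
  set b := ‖β‖ with hb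
  have hb0 : 0 ≤ b := norm_nonneg _
  have hE0 : 0 < E := by linarith
  have hEN : (E ^ N)⁻¹ ≤ 1 := inv_le_one_of_one_le₀ (one_le_pow₀ hE)
  have hbE : b ≤ E * b := le_mul_of_one_le_left hb0 hE
  set T := (M.factorial : ℝ) * Real.exp (L * (E * b)) with hT
  have hT0 : 0 ≤ T := by positivity
  have h1 : ‖∑ s ∈ Finset.range (M + 1), ∑ l ∈ Finset.range L,
      (p s l : ℂ) * (β ^ s * Complex.exp (l * β))‖ ≤ (E ^ N)⁻¹ * (H * T) := by
    refine (norm_sum_exp_le_of_vanishing p _ _ N β hE hp).trans ?_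
    refine mul_le_mul_of_nonneg_left ?_ (by positivity)
    refine le_trans ?_ (mul_le_mul_of_nonneg_right hH hT0)
    simp_rw [Finset.sum_mul]
    refine Finset.sum_le_sum fun s hs => Finset.sum_le_sum fun l hl => ?_
    exact mul_le_mul_of_nonneg_left (pow_mul_exp_le (by positivity) (Finset.mem_range.1 hs)
      (Finset.mem_range.1 hl)) (abs_nonneg _)
  have hexp : ‖Complex.exp β‖ ≤ Real.exp b := by
    rw [Complex.norm_exp]
    exact Real.exp_le_exp.2 (Complex.re_le_norm β)
  have hexp1 : 1 ≤ Real.exp b := Real.one_le_exp hb0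
  have hαR : ‖α‖ ≤ 2 * Real.exp b := by
    have : ‖α‖ ≤ ‖Complex.exp β‖ + ‖Complex.exp β - α‖ := by
      have h := norm_sub_norm_le α (Complex.exp β)
      rw [norm_sub_rev] at h
      linarith
    linarith
  have hterm : ∀ s ∈ Finset.range (M + 1), ∀ l ∈ Finset.range L,
      ‖(p s l : ℂ) * (β ^ s * (Complex.exp β ^ l - α ^ l))‖ ≤
        |(p s l : ℝ)| * ((E ^ N)⁻¹ * T * ((L - 1) * 2 ^ (L - 1))) := by
    intro s hs l hl
    have hlL := Finset.mem_range.1 hl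
    rw [norm_mul, norm_mul, norm_pow, Complex.norm_intCast]
    refine mul_le_mul_of_nonneg_left ?_ (abs_nonneg _)
    have h2 := norm_pow_sub_pow_le_mul (x := Complex.exp β) (y := α) (R := 2 * Real.exp b)
      (by linarith) (by linarith) hαR l
    have h3 := pow_mul_exp_le hb0 (Finset.mem_range.1 hs) hlL
    have h4 : (M.factorial : ℝ) * Real.exp (L * b) ≤ T := by
      rw [hT]; gcongr
    have h5 : (l : ℝ) ≤ L - 1 := by
      have : ((l + 1 : ℕ) : ℝ) ≤ L := by exact_mod_cast hlL
      push_cast at this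
      linarith
    have hl0 : (0 : ℝ) ≤ l := by positivity
    calc b ^ s * ‖Complex.exp β ^ l - α ^ l‖
        ≤ b ^ s * (l * (2 * Real.exp b) ^ l * (E ^ N)⁻¹) := by
          refine mul_le_mul_of_nonneg_left (h2.trans ?_) (by positivity)
          gcongr
      _ = (E ^ N)⁻¹ * (b ^ s * Real.exp (l * b)) * (l * 2 ^ l) := by
          rw [mul_pow, ← Real.exp_nat_mul]
          ring
      _ ≤ (E ^ N)⁻¹ * T * ((L - 1) * 2 ^ (L - 1)) := by
          have h6 : (2 : ℝ) ^ l ≤ 2 ^ (L - 1) := pow_le_pow_right₀ (by norm_num) (by omega)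
          have h7 := h3.trans h4
          gcongr
          linarith
  -- `Λ` is the value of the exponential form, small by vanishing, minus an error caused by
  -- replacing `e^β` by `α`.
  have hsplit : ∑ s ∈ Finset.range (M + 1), ∑ l ∈ Finset.range L, (p s l : ℂ) * β ^ s * α ^ l =
      ∑ s ∈ Finset.range (M + 1), ∑ l ∈ Finset.range L,
        (p s l : ℂ) * (β ^ s * Complex.exp (l * β)) -
      ∑ s ∈ Finset.range (M + 1), ∑ l ∈ Finset.range L,
        (p s l : ℂ) * (β ^ s * (Complex.exp β ^ l - α ^ l)) := by
    simp_rw [← Finset.sum_sub_distrib]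
    refine Finset.sum_congr rfl fun s _ => Finset.sum_congr rfl fun l _ => ?_
    rw [Complex.exp_nat_mul]
    ring
  have hL1 : (1 : ℝ) ≤ L := by exact_mod_cast hL
  have h2 : ‖∑ s ∈ Finset.range (M + 1), ∑ l ∈ Finset.range L,
      (p s l : ℂ) * (β ^ s * (Complex.exp β ^ l - α ^ l))‖ ≤
      H * ((E ^ N)⁻¹ * T * ((L - 1) * 2 ^ (L - 1))) := by
    have h0 : (0 : ℝ) ≤ L - 1 := by linarith
    refine le_trans ?_ (mul_le_mul_of_nonneg_right hH (by positivity))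
    simp_rw [Finset.sum_mul]
    exact norm_sum_le_of_le _ fun s hs => norm_sum_le_of_le _ fun l hl => hterm s hs l hl
  have hH0 : 0 ≤ H := le_trans (by positivity) hH
  have h2pow : (1 : ℝ) ≤ 2 ^ (L - 1) := one_le_pow₀ (by norm_num)
  rw [hsplit]
  calc _ ≤ (E ^ N)⁻¹ * (H * T) + H * ((E ^ N)⁻¹ * T * ((L - 1) * 2 ^ (L - 1))) :=
        (norm_sub_le _ _).trans (add_le_add h1 h2)
    _ = (E ^ N)⁻¹ * H * T * (1 + (L - 1) * 2 ^ (L - 1)) := by ring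
    _ ≤ (E ^ N)⁻¹ * H * T * (L * 2 ^ (L - 1)) := by
        refine mul_le_mul_of_nonneg_left ?_ (by positivity)
        linarith
    _ = _ := by rw [hT]; ring

/-! ### Comparison of the two bounds -/

lemma log_natCast_le_sub_one_mul_log_two {L : ℕ} (hL : 1 ≤ L) :
    Real.log L ≤ (L - 1) * Real.log 2 := by
  have h : L ≤ 2 ^ (L - 1) := by
    have := Nat.lt_two_pow_self (n := L - 1)
    omega
  have h' : (L : ℝ) ≤ 2 ^ (L - 1) := by exact_mod_cast h
  have := Real.log_le_log (by exact_mod_cast hL) h'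
  rwa [Real.log_pow, Nat.cast_sub hL, Nat.cast_one] at this

theorem mainTheorem1 (α β : ℂ) (hα : IsAlgebraic ℚ α) (hβ : IsAlgebraic ℚ β) (hβ0 : β ≠ 0)
    (A B : ℝ) (hA : 1 ≤ A) (hB : 1 ≤ B)
    (hαA : degreeRatio α β * weilHeight α - Real.log (max 1 ‖α‖) ≤ Real.log A)
    (hβB : degreeRatio α β * weilHeight β - Real.log (max 1 ‖β‖) ≤ Real.log B)
    (K L : ℕ) (hK : 1 ≤ K) (hL : 2 ≤ L) (E : ℝ) (hE : 1 < E)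
    (hineq :
      degreeRatio α β * K * L * Real.log 2
        + degreeRatio α β * ((K : ℝ) - 1)
            * Real.log (Real.exp 1 * √(3 * (L : ℝ)) * (lcmUpTo (L - 1) : ℝ))
        + degreeRatio α β * Real.log (factorialPart (K - 1) (L - 1))
        + degreeRatio α β
            * Real.log ((4 * Real.exp 1) ^ (L - 1)
                * min ((lcmUpTo (L - 2) : ℝ) ^ (K - 1)) ((L - 2).factorial : ℝ))
        + Real.log ((K - 1).factorial : ℝ)
        + ((K : ℝ) - 1) * Real.log (B / 2)
        + ((L : ℝ) - 1) * Real.log (A / 2)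
        + L * E * ‖β‖
        + L * Real.log E
      ≤ K * L * Real.log E) :
    E ^ (-((K : ℤ) * (L : ℤ))) ≤ ‖Complex.exp β - α‖ := by
  by_contra! hlt
  obtain ⟨M, rfl⟩ : ∃ M, K = M + 1 := ⟨K - 1, by omega⟩
  rw [Nat.add_sub_cancel] at hineq
  set D := degreeRatio α β with hDdef
  have hD : 1 ≤ D := one_le_degreeRatio hα hβ
  have hE0 : 0 < E := by linarith
  obtain ⟨p, hvan, hlen, hne⟩ := exists_int_pade_form M hL α hβ0
  obtain ⟨R, hR0, hR, -⟩ := exists_nat_factorialPart M (L - 1)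
  have hF0 : 0 < factorialPart M (L - 1) := by rw [hR]; exact_mod_cast hR0
  have hd0 : (0 : ℝ) < lcmUpTo (L - 1) := by exact_mod_cast lcmUpTo_pos _
  have hL2 : (2 : ℝ) ≤ L := by exact_mod_cast hL
  have hL0 : (0 : ℝ) < L := by linarith
  have hs0 : 0 < √(3 * (L : ℝ)) := Real.sqrt_pos.2 (by linarith)
  obtain ⟨H, hH⟩ : ∃ H, H = (lcmUpTo (L - 1) : ℝ) ^ M * factorialPart M (L - 1) *
    (L * (2 * (2 ^ L * √(3 * L)) ^ M)) := ⟨_, rfl⟩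
  rw [← hH] at hlen
  have hH0 : 0 < H := by rw [hH]; positivity
  -- The order of vanishing is only `ML = (K - 1)L`, so closeness is weakened to match; the term `L
  -- log E` of the hypothesis accounts for the difference.
  have hclose : ‖Complex.exp β - α‖ ≤ (E ^ (M * L))⁻¹ := by
    refine hlt.le.trans ?_
    rw [zpow_neg, show ((M + 1 : ℕ) : ℤ) * (L : ℤ) = (((M + 1) * L : ℕ) : ℤ) by push_cast; ring,
      zpow_natCast]
    gcongr
    · exact hE.le
    · omega
  have hupper := norm_sum_le_of_vanishing_of_norm_exp_sub_le p M (by omega) α β hE.le hvan hlen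
    hclose
  have hlower := liouville_inequality_degreeRatio hα hβ p M (L - 1) H
    (by rwa [Nat.sub_add_cancel (by omega)]) (by rwa [Nat.sub_add_cancel (by omega)])
  rw [Nat.sub_add_cancel (by omega), Nat.cast_sub (by omega), Nat.cast_one, ← hDdef] at hlower
  have hlogup := Real.log_le_log (norm_pos_iff.2 hne) hupper
  have hfac0 : (0 : ℝ) < M.factorial := by exact_mod_cast M.factorial_pos
  rw [Real.log_mul (by positivity) (by positivity), Real.log_mul (by positivity) (by positivity),
    Real.log_mul (by positivity) (by positivity), Real.log_mul (by positivity) (by positivity),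
    Real.log_mul (by positivity) (by positivity), Real.log_inv, Real.log_pow, Real.log_exp,
    Real.log_pow, Nat.cast_mul, Nat.cast_sub (by omega), Nat.cast_one] at hlogup
  have hlogH : Real.log H = M * Real.log (lcmUpTo (L - 1)) + Real.log (factorialPart M (L - 1)) +
      (Real.log L + (Real.log 2 + M * (L * Real.log 2 + Real.log √(3 * L)))) := by
    rw [hH, Real.log_mul (by positivity) (by positivity),
      Real.log_mul (by positivity) (by positivity), Real.log_mul (by positivity) (by positivity),
      Real.log_mul (by positivity) (by positivity), Real.log_pow, Real.log_pow,
      Real.log_mul (by positivity) (by positivity), Real.log_pow]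
  have hmin : 1 ≤ min ((lcmUpTo (L - 2) : ℝ) ^ M) ((L - 2).factorial : ℝ) :=
    le_min (one_le_pow₀ (by exact_mod_cast lcmUpTo_pos _))
      (by exact_mod_cast Nat.factorial_pos _)
  have hlog4 : (L - 1) * (2 * Real.log 2 + 1) ≤ Real.log ((4 * Real.exp 1) ^ (L - 1) *
      min ((lcmUpTo (L - 2) : ℝ) ^ M) ((L - 2).factorial : ℝ)) := by
    rw [Real.log_mul (by positivity) (by positivity), Real.log_pow,
      Real.log_mul (by norm_num) (by positivity), Real.log_exp,
      show (4 : ℝ) = 2 ^ 2 by norm_num, Real.log_pow, Nat.cast_sub (by omega)]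
    have := Real.log_nonneg hmin
    push_cast
    linarith
  rw [Real.log_mul (by positivity) (by positivity), Real.log_mul (by positivity) (by positivity),
    Real.log_exp, Real.log_div (by positivity) (by norm_num),
    Real.log_div (by positivity) (by norm_num)] at hineq
  push_cast at hineq
  have hM0 : (0 : ℝ) ≤ M := by positivity
  have hβ' := mul_le_mul_of_nonneg_left hβB hM0
  have hα' := mul_le_mul_of_nonneg_left hαA (show (0 : ℝ) ≤ L - 1 by linarith)
  have hD4 := mul_le_mul_of_nonneg_left hlog4 (show 0 ≤ D by linarith)
  have hlogL := log_natCast_le_sub_one_mul_log_two (L := L) (by omega)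
  have hℓ := Real.log_two_lt_d9
  have hℓ0 : 0 < Real.log 2 := Real.log_pos (by norm_num)
  -- `D * Y` is the slack left in the terms carrying `D` once `D * log H` is subtracted: it comes
  -- from one extra `L log 2`, the factor `e` in `e√(3L)`, and `(4e)^(L-1)`.
  set Y := L * Real.log 2 + M + (L - 1) * (2 * Real.log 2 + 1) - Real.log L - Real.log 2 with hY
  have hYlow : M + 2 * ((L - 1) * Real.log 2) + (L - 1) ≤ Y := by
    rw [hY]; linarith
  have hY0 : 0 ≤ Y := by
    have : 0 ≤ (L - 1) * Real.log 2 := mul_nonneg (by linarith) hℓ0.le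
    linarith
  have hDY : Y ≤ D * Y := le_mul_of_one_le_left hY0 hD
  have hYup : D * Y ≤ (M + (L - 1)) * Real.log 2 + Real.log L + (L - 1) * Real.log 2 := by
    have hexpand : D * Y = D * (L * Real.log 2) + D * M + D * ((L - 1) * (2 * Real.log 2 + 1)) -
        D * Real.log L - D * Real.log 2 := by
      rw [hY]; ring
    have hDH : D * Real.log H = D * (M * Real.log (lcmUpTo (L - 1))) +
        D * Real.log (factorialPart M (L - 1)) + D * Real.log L + D * Real.log 2 +
        D * (M * (L * Real.log 2)) + D * (M * Real.log √(3 * L)) := by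
      rw [hlogH]; ring
    linarith
  -- Since `D ≥ 1` and `log L ≤ (L - 1) log 2`, the bounds on `Y` give `M + L - 1 ≤ (M + L - 1) log
  -- 2`, which is impossible.
  have hgap : 0 < (M + (L - 1)) * (1 - Real.log 2) :=
    mul_pos (by linarith) (by linarith)
  linarith
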